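/- Let $\mathrm{Heis}$ be the 3-dimensional real Heisenberg group, i.e. $\mathbf R^3$ with $(x,y,z)(x',y',z')=(x+x',\,y+y',\,z+z'+xy')$, and let $\mathfrak{heis}$ be its Lie algebra. A Lorentz metric on an $n$-manifold is a smooth field of non-degenerate quadratic forms of signature $(n-1,1)$. For a Lorentz metric $g$ on $\mathrm{Heis}$ let $\mathrm{Isom}(g)$ be the group of smooth diffeomorphisms preserving $g$, with the compact-open topology, and $\mathrm{Isom}^0(g)$ its identity component. Let $\mathcal L$ be the set of left-invariant Lorentz metrics $g$ on $\mathrm{Heis}$ which give positive length to the center of $\mathfrak{heis}$ (i.e. $g(X,X)>0$ for every non-zero central $X\in\mathfrak{heis}$). **Proposition.** (1) $\mathcal L$ is non-empty, and it consists of a single metric up to automorphism and multiplicative constant: for all $g_1,g_2\in\mathcal L$ there are a (smooth) automorphism $\sigma$ of the Lie group $\mathrm{Heis}$ and a constant $c>0$ such that $\sigma^*g_2=c\,g_1$. (2) All the metrics of $\mathcal L$ define the same geometry: for all $g_1,g_2\in\mathcal L$ there is a smooth diffeomorphism $\Phi$ of $\mathrm{Heis}$ with $\Phi\,\mathrm{Isom}^0(g_1)\,\Phi^{-1}=\mathrm{Isom}^0(g_2)$.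 (3) Let $g\in\mathcal L$. Then $\mathrm{Isom}^0(g)$ is isomorphic, as a topological group, to the 4-dimensional Lie group $G=\mathbf R\ltimes \mathrm{Heis}$, where $t\in\mathbf R$ acts on $\mathrm{Heis}$ by $(x,y,z)\mapsto(e^tx,e^{-t}y,z)$, and through this isomorphism $G$ acts smoothly, faithfully and transitively on $\mathrm{Heis}$, preserving a Lorentz metric. Moreover: - this geometry is non-Riemannian: no Riemannian metric on $\mathrm{Heis}$ is preserved by $G$; - it is maximal: the action of $G$ on $\mathrm{Heis}$ does not extend to a smooth faithful action on $\mathrm{Heis}$ of a Lie group $G'$ with $\dim G'>4$ which preserves a Lorentz metric; - its isotropy is semisimple: for every $p\in\mathrm{Heis}$ there are a basis of $T_p\mathrm{Heis}$ and a vector $c\in\mathbf R^3\setminus\{0\}$ such that the differentials at $p$ of the elements of $G$ fixing $p$ are, in this basis, exactly the matrices $\mathrm{diag}(e^{tc_1},e^{tc_2},e^{tc_3})$, $t\in\mathbf R$. This geometry is called Lorentz-Heisenberg. -/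

import Mathlib

open scoped Manifold ContDiff

namespace LorentzHeis

section General

variable {E : Type*} [NormedAddCommGroup E] [NormedSpace ℝ E] {H : Type*} [TopologicalSpace H]

/-- A field of bilinear forms on the tangent spaces of `M`. -/
abbrev BilinField (I : ModelWithCorners ℝ E H) (M : Type*) [TopologicalSpace M]
    [ChartedSpace H M] : Type _ :=
  ∀ x : M, TangentSpace I x →L[ℝ] TangentSpace I x →L[ℝ] ℝ

/-- `f` preserves the field `B`, i.e. `f^* B = B`. -/
def Preserves (I : ModelWithCorners ℝ E H) {M : Type*} [TopologicalSpace M] [ChartedSpace H M]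
    (B : BilinField I M) (f : M → M) : Prop :=
  ∀ (x : M) (v w : TangentSpace I x), B (f x) (mfderiv I I f x v) (mfderiv I I f x w) = B x v w

/-- A smooth Lorentz metric: a smooth field of symmetric bilinear forms of signature
`(n - 1, 1)`. The signature is expressed by the existence of a vector `v` with `⟨v, v⟩ < 0` whose
orthogonal complement is positive definite. -/
structure LorentzMetric (I : ModelWithCorners ℝ E H) (M : Type*) [TopologicalSpace M]
    [ChartedSpace H M] [IsManifold I ∞ M] where
  form : BilinField I M
  symm : ∀ (x : M) (v w : TangentSpace I x), form x v w = form x w v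
  signature : ∀ x : M, ∃ v : TangentSpace I x, form x v v < 0 ∧
    ∀ w : TangentSpace I x, form x v w = 0 → w ≠ 0 → 0 < form x w w
  contMDiff : ContMDiff I (I.prod 𝓘(ℝ, E →L[ℝ] E →L[ℝ] ℝ)) ∞
    (fun x ↦ Bundle.TotalSpace.mk' (E →L[ℝ] E →L[ℝ] ℝ)
      (E := fun x : M ↦ TangentSpace I x →L[ℝ] TangentSpace I x →L[ℝ] ℝ) x (form x))

/-- The compact-open topology on the group of homeomorphisms. -/
instance homeoCompactOpen (M : Type*) [TopologicalSpace M] : TopologicalSpace (M ≃ₜ M) :=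
  TopologicalSpace.induced (fun φ ↦ (⟨φ, φ.continuous⟩ : C(M, M))) inferInstance

/-- The dimension of the manifolds modelled on `I`. -/
noncomputable def modelDim (_ : ModelWithCorners ℝ E H) : ℕ := Module.finrank ℝ E

variable {I : ModelWithCorners ℝ E H} {M : Type*} [TopologicalSpace M] [ChartedSpace H M]

theorem Preserves.comp {B : BilinField I M} {f h : M → M} (hf : Preserves I B f)
    (hh : Preserves I B h) (sf : ContMDiff I I ∞ f) (sh : ContMDiff I I ∞ h) :
    Preserves I B (f ∘ h) := by
  intro x v w
  have key : mfderiv I I (f ∘ h) x = (mfderiv I I f (h x)).comp (mfderiv I I h x) :=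
    mfderiv_comp x ((sf (h x)).mdifferentiableAt (by simp)) ((sh x).mdifferentiableAt (by simp))
  rw [key]
  exact (hf (h x) _ _).trans (hh x v w)

theorem Preserves.symm {B : BilinField I M} {φ : M ≃ₜ M} (hf : Preserves I B φ)
    (sf : ContMDiff I I ∞ φ) (sh : ContMDiff I I ∞ φ.symm) :
    Preserves I B φ.symm := by
  intro x v w
  obtain ⟨y, rfl⟩ : ∃ y, φ y = x := ⟨φ.symm x, φ.apply_symm_apply x⟩
  have key : mfderiv I I (φ ∘ φ.symm) (φ y) =
      (mfderiv I I φ (φ.symm (φ y))).comp (mfderiv I I φ.symm (φ y)) :=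
    mfderiv_comp _ ((sf _).mdifferentiableAt (by simp)) ((sh _).mdifferentiableAt (by simp))
  have hid : (φ ∘ φ.symm : M → M) = id := by ext z; simp
  have h2 := hf (φ.symm (φ y)) (mfderiv I I φ.symm (φ y) v) (mfderiv I I φ.symm (φ y) w)
  rw [← h2]
  have e : ∀ u : TangentSpace I (φ y),
      (mfderiv I I φ (φ.symm (φ y)) (mfderiv I I φ.symm (φ y) u) : E) = u := by
    intro u
    have := congrArg (fun L ↦ (L u : E)) key
    rw [hid] at this
    simp only [mfderiv_id] at this
    exact this.symm
  have e3 : ∀ (a b : M) (_ : a = b) (v w : E),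
      B a (show TangentSpace I a from v) (show TangentSpace I a from w) =
      B b (show TangentSpace I b from v) (show TangentSpace I b from w) := by
    rintro a _ rfl v w; rfl
  have := e3 (φ (φ.symm (φ y))) (φ y) (by simp) v w
  rw [show (mfderiv I I φ (φ.symm (φ y)) (mfderiv I I φ.symm (φ y) v)) = v from e v,
    show (mfderiv I I φ (φ.symm (φ y)) (mfderiv I I φ.symm (φ y) w)) = w from e w]
  exact this

/-- The isometry group of `g`: smooth diffeomorphisms of `M` preserving `g`. -/
def isom [IsManifold I ∞ M] (g : LorentzMetric I M) : Subgroup (M ≃ₜ M) where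
  carrier := {φ | ContMDiff I I ∞ φ ∧ ContMDiff I I ∞ φ.symm ∧ Preserves I g.form φ}
  one_mem' := by
    refine ⟨contMDiff_id, contMDiff_id, fun x v w ↦ ?_⟩
    change g.form x (mfderiv I I id x v) (mfderiv I I id x w) = _
    rw [mfderiv_id]
    rfl
  mul_mem' := by
    rintro a b ⟨ha, ha', pa⟩ ⟨hb, hb', pb⟩
    exact ⟨ha.comp hb, hb'.comp ha', pa.comp pb ha hb⟩
  inv_mem' := by
    rintro a ⟨ha, ha', pa⟩
    exact ⟨ha', ha, pa.symm ha ha'⟩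

/-- The identity component of the isometry group, for the compact-open topology. -/
def isomZero [IsManifold I ∞ M] (g : LorentzMetric I M) : Set (M ≃ₜ M) :=
  connectedComponentIn (isom g : Set (M ≃ₜ M)) 1

/-- Two Lorentz metrics on `M` define the same geometry: the identity components of their isometry
groups are conjugate in the group of diffeomorphisms of `M`. -/
def SameGeometry [IsManifold I ∞ M] (g₁ g₂ : LorentzMetric I M) : Prop :=
  ∃ Φ : M ≃ₜ M, ContMDiff I I ∞ Φ ∧ ContMDiff I I ∞ Φ.symm ∧
    ∀ ψ : M ≃ₜ M, ψ ∈ isomZero g₁ ↔ Φ * ψ * Φ⁻¹ ∈ isomZero g₂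

section Actions

variable {F : Type*} [NormedAddCommGroup F] [NormedSpace ℝ F] {K : Type*} [TopologicalSpace K]
  {G : Type*} [Group G] [TopologicalSpace G] [ChartedSpace K G]

/-- The action `ρ` of the Lie group `G` on the manifold `M` is smooth. -/
def SmoothAction (J : ModelWithCorners ℝ F K) (I : ModelWithCorners ℝ E H)
    (ρ : G →* (M ≃ₜ M)) : Prop :=
  ContMDiff (J.prod I) I ∞ (fun q : G × M ↦ ρ q.1 q.2)

/-- A Lorentz geometry, seen as a smooth faithful transitive action of a Lie group `G` on `M`
which preserves some Lorentz metric. -/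
structure IsLorentzGeometry (J : ModelWithCorners ℝ F K) (I : ModelWithCorners ℝ E H)
    [LieGroup J ∞ G] [IsManifold I ∞ M] (ρ : G →* (M ≃ₜ M)) : Prop where
  smooth : SmoothAction J I ρ
  faithful : Function.Injective ρ
  transitive : ∀ x y : M, ∃ a : G, ρ a x = y
  lorentz : ∃ g : LorentzMetric I M, ∀ a : G, Preserves I g.form (ρ a)

/-- The geometry is non-Riemannian: the action preserves no Riemannian metric. -/
def NonRiemannian (I : ModelWithCorners ℝ E H) [IsManifold I ∞ M] (ρ : G →* (M ≃ₜ M)) : Prop :=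
  ¬ ∃ h : Bundle.ContMDiffRiemannianMetric I ∞ E (fun x : M ↦ TangentSpace I x),
    ∀ a : G, Preserves I h.inner (ρ a)

/-- The geometry is maximal: the action of `G` does not extend to a smooth faithful action on `M`
of a Lie group `G'` with `dim G' > dim G` which preserves a Lorentz metric. -/
def IsMaximalGeometry (J : ModelWithCorners ℝ F K) (I : ModelWithCorners ℝ E H)
    [LieGroup J ∞ G] [IsManifold I ∞ M] (ρ : G →* (M ≃ₜ M)) : Prop :=
  ∀ n : ℕ, modelDim J < n →
    ∀ (G' : Type) [Group G'] [TopologicalSpace G'] [ChartedSpace (EuclideanSpace ℝ (Fin n)) G']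
      [LieGroup (𝓡 n) ∞ G'] (ρ' : G' →* (M ≃ₜ M)),
      SmoothAction (𝓡 n) I ρ' → Function.Injective ρ' →
      (∃ g : LorentzMetric I M, ∀ a : G', Preserves I g.form (ρ' a)) →
      ¬ ∃ j : G →* G', ∀ a : G, ρ' (j a) = ρ a

/-- The isotropy at `p` is semisimple: in a suitable basis of `T_p M`, the differentials at `p` of
the elements which fix `p` are exactly the maps of a non-trivial diagonal one-parameter group
`diag (exp (t c₁), …, exp (t cₙ))`, `t ∈ ℝ`. (`TangentSpace I p` is `E` by definition.) -/
def SemisimpleIsotropy (I : ModelWithCorners ℝ E H) (ρ : G →* (M ≃ₜ M)) (p : M) : Prop :=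
  ∃ (b : Module.Basis (Fin (Module.finrank ℝ E)) ℝ E) (c : Fin (Module.finrank ℝ E) → ℝ),
    c ≠ 0 ∧
    (∀ t : ℝ, ∃ a : G, ρ a p = p ∧
      ∀ i, (mfderiv I I (ρ a) p (b i) : E) = Real.exp (t * c i) • b i) ∧
    (∀ a : G, ρ a p = p → ∃ t : ℝ,
      ∀ i, (mfderiv I I (ρ a) p (b i) : E) = Real.exp (t * c i) • b i)

/-- `ρ` is an isomorphism of topological groups from `G` onto the identity component of the
isometry group of `g`. -/
structure IsIsomZero [IsManifold I ∞ M] (ρ : G →* (M ≃ₜ M)) (g : LorentzMetric I M) : Prop where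
  isEmbedding : Topology.IsEmbedding ρ
  range_eq : Set.range ρ = isomZero g

end Actions

section LeftInvariant

variable {G : Type*} [Group G] [TopologicalSpace G] [ChartedSpace H G]

/-- Left-invariant Lorentz metrics on a Lie group. -/
def LeftInvariant [LieGroup I ∞ G] (g : LorentzMetric I G) : Prop :=
  ∀ a : G, Preserves I g.form (fun x ↦ a * x)

/-- The metric is positive on the non-zero elements of the center of the Lie algebra. -/
def CenterPositive [CompleteSpace E] [LieGroup I (minSmoothness ℝ 3) G] [IsManifold I ∞ G]
    (g : LorentzMetric I G) : Prop :=
  ∀ X ∈ LieAlgebra.center ℝ (GroupLieAlgebra I G), X ≠ 0 → 0 < g.form 1 X X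

end LeftInvariant

end General

/-- The Heisenberg group `Heis`, with its global coordinates `(x, y, z)` and the group law
`(x, y, z) (x', y', z') = (x + x', y + y', z + z' + x y')`. -/
def Heis : Type := ℝ × ℝ × ℝ

namespace Heis

instance : TopologicalSpace Heis := inferInstanceAs (TopologicalSpace (ℝ × ℝ × ℝ))

instance : ChartedSpace (ℝ × ℝ × ℝ) Heis :=
  inferInstanceAs (ChartedSpace (ℝ × ℝ × ℝ) (ℝ × ℝ × ℝ))

instance (n : ℕ∞ω) : IsManifold 𝓘(ℝ, ℝ × ℝ × ℝ) n Heis :=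
  inferInstanceAs (IsManifold 𝓘(ℝ, ℝ × ℝ × ℝ) n (ℝ × ℝ × ℝ))

instance : Mul Heis := ⟨fun p q ↦ (p.1 + q.1, p.2.1 + q.2.1, p.2.2 + q.2.2 + p.1 * q.2.1)⟩

instance : One Heis := ⟨((0, 0, 0) : ℝ × ℝ × ℝ)⟩

instance : Inv Heis := ⟨fun p ↦ (-p.1, -p.2.1, -p.2.2 + p.1 * p.2.1)⟩

theorem mul_def (p q : Heis) :
    p * q = (p.1 + q.1, p.2.1 + q.2.1, p.2.2 + q.2.2 + p.1 * q.2.1) := rfl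

theorem one_def : (1 : Heis) = ((0, 0, 0) : ℝ × ℝ × ℝ) := rfl

theorem inv_def (p : Heis) : p⁻¹ = (-p.1, -p.2.1, -p.2.2 + p.1 * p.2.1) := rfl

instance : Group Heis :=
  Group.ofLeftAxioms
    (by
      intro p q r
      refine Prod.ext ?_ (Prod.ext ?_ ?_)
      · change p.1 + q.1 + r.1 = p.1 + (q.1 + r.1)
        ring
      · change p.2.1 + q.2.1 + r.2.1 = p.2.1 + (q.2.1 + r.2.1)
        ring
      · change p.2.2 + q.2.2 + p.1 * q.2.1 + r.2.2 + (p.1 + q.1) * r.2.1 =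
          p.2.2 + (q.2.2 + r.2.2 + q.1 * r.2.1) + p.1 * (q.2.1 + r.2.1)
        ring)
    (by
      intro p
      refine Prod.ext ?_ (Prod.ext ?_ ?_)
      · change 0 + p.1 = p.1
        ring
      · change 0 + p.2.1 = p.2.1
        ring
      · change 0 + p.2.2 + 0 * p.2.1 = p.2.2
        ring)
    (by
      intro p
      refine Prod.ext ?_ (Prod.ext ?_ ?_)
      · change -p.1 + p.1 = 0
        ring
      · change -p.2.1 + p.2.1 = 0
        ring
      · change -p.2.2 + p.1 * p.2.1 + p.2.2 + -p.1 * p.2.1 = 0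
        ring)

instance : LieGroup 𝓘(ℝ, ℝ × ℝ × ℝ) ω Heis where
  contMDiff_mul := by
    have h : ContDiff ℝ ω (fun q : (ℝ × ℝ × ℝ) × (ℝ × ℝ × ℝ) ↦
        ((q.1.1 + q.2.1, q.1.2.1 + q.2.2.1, q.1.2.2 + q.2.2.2 + q.1.1 * q.2.2.1) :
          ℝ × ℝ × ℝ)) := by fun_prop
    have h' := h.contMDiff
    rw [modelWithCornersSelf_prod, ← chartedSpaceSelf_prod] at h'
    exact h'
  contMDiff_inv := by
    have h : ContDiff ℝ ω (fun q : ℝ × ℝ × ℝ ↦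
        ((-q.1, -q.2.1, -q.2.2 + q.1 * q.2.1) : ℝ × ℝ × ℝ)) := by fun_prop
    exact h.contMDiff

/-- The one-parameter group of automorphisms `(x, y, z) ↦ (e^t x, e^{-t} y, z)` of `Heis`. -/
noncomputable def boost : Multiplicative ℝ →* MulAut Heis where
  toFun t :=
    { toFun := fun p ↦ (Real.exp t.toAdd * p.1, Real.exp (-t.toAdd) * p.2.1, p.2.2)
      invFun := fun p ↦ (Real.exp (-t.toAdd) * p.1, Real.exp t.toAdd * p.2.1, p.2.2)
      left_inv := by
        intro p
        refine Prod.ext ?_ (Prod.ext ?_ rfl) <;>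
        simp [← mul_assoc, ← Real.exp_add]
      right_inv := by
        intro p
        refine Prod.ext ?_ (Prod.ext ?_ rfl) <;>
        simp [← mul_assoc, ← Real.exp_add]
      map_mul' := by
        intro p q
        have h : Real.exp t.toAdd * Real.exp (-t.toAdd) = 1 := by simp [← Real.exp_add]
        refine Prod.ext ?_ (Prod.ext ?_ ?_)
        · exact mul_add _ p.1 q.1
        · exact mul_add _ p.2.1 q.2.1
        · change p.2.2 + q.2.2 + p.1 * q.2.1 = p.2.2 + q.2.2 +
            Real.exp t.toAdd * p.1 * (Real.exp (-t.toAdd) * q.2.1)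
          linear_combination (-(p.1 * q.2.1)) * h }
  map_one' := by
    ext p
    refine Prod.ext ?_ (Prod.ext ?_ rfl)
    · change Real.exp 0 * p.1 = p.1
      simp
    · change Real.exp (-0) * p.2.1 = p.2.1
      simp
  map_mul' := by
    intro s t
    ext p
    refine Prod.ext ?_ (Prod.ext ?_ rfl)
    · change Real.exp (s.toAdd + t.toAdd) * p.1 = Real.exp s.toAdd * (Real.exp t.toAdd * p.1)
      rw [Real.exp_add, mul_assoc]
    · change Real.exp (-(s.toAdd + t.toAdd)) * p.2.1 =
        Real.exp (-s.toAdd) * (Real.exp (-t.toAdd) * p.2.1)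
      rw [neg_add, Real.exp_add, mul_assoc]

theorem boost_apply (t : Multiplicative ℝ) (p : Heis) :
    boost t p = (Real.exp t.toAdd * p.1, Real.exp (-t.toAdd) * p.2.1, p.2.2) := rfl

end Heis

/-- The Lie group `ℝ ⋉ Heis`, where `t ∈ ℝ` acts on `Heis` by `(x, y, z) ↦ (e^t x, e^{-t} y, z)`,
with its global coordinates `(t, h)`. -/
def BoostHeis : Type := ℝ × Heis

namespace BoostHeis

instance : TopologicalSpace BoostHeis := inferInstanceAs (TopologicalSpace (ℝ × ℝ × ℝ × ℝ))

instance : ChartedSpace (ℝ × ℝ × ℝ × ℝ) BoostHeis :=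
  inferInstanceAs (ChartedSpace (ℝ × ℝ × ℝ × ℝ) (ℝ × ℝ × ℝ × ℝ))

instance (n : ℕ∞ω) : IsManifold 𝓘(ℝ, ℝ × ℝ × ℝ × ℝ) n BoostHeis :=
  inferInstanceAs (IsManifold 𝓘(ℝ, ℝ × ℝ × ℝ × ℝ) n (ℝ × ℝ × ℝ × ℝ))

/-- The coordinates identify `BoostHeis` with the semidirect product of groups. -/
def equivSemidirect : BoostHeis ≃ Heis ⋊[Heis.boost] Multiplicative ℝ where
  toFun a := ⟨a.2, Multiplicative.ofAdd a.1⟩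
  invFun a := (a.right.toAdd, a.left)
  left_inv _ := rfl
  right_inv _ := rfl

noncomputable instance : Group BoostHeis := equivSemidirect.group

theorem mul_def (a b : BoostHeis) :
    a * b = (a.1 + b.1, a.2 * Heis.boost (Multiplicative.ofAdd a.1) b.2) := rfl

theorem inv_def (a : BoostHeis) :
    a⁻¹ = (-a.1, Heis.boost (Multiplicative.ofAdd (-a.1)) a.2⁻¹) := rfl

noncomputable instance : LieGroup 𝓘(ℝ, ℝ × ℝ × ℝ × ℝ) ω BoostHeis where
  contMDiff_mul := by
    have h : ContDiff ℝ ω (fun q : (ℝ × ℝ × ℝ × ℝ) × (ℝ × ℝ × ℝ × ℝ) ↦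
        ((q.1.1 + q.2.1, q.1.2.1 + Real.exp q.1.1 * q.2.2.1,
          q.1.2.2.1 + Real.exp (-q.1.1) * q.2.2.2.1,
          q.1.2.2.2 + q.2.2.2.2 + q.1.2.1 * (Real.exp (-q.1.1) * q.2.2.2.1)) :
          ℝ × ℝ × ℝ × ℝ)) := by fun_prop
    have h' := h.contMDiff
    rw [modelWithCornersSelf_prod, ← chartedSpaceSelf_prod] at h'
    exact h'
  contMDiff_inv := by
    have h : ContDiff ℝ ω (fun q : ℝ × ℝ × ℝ × ℝ ↦
        ((-q.1, Real.exp (-q.1) * -q.2.1, Real.exp (- -q.1) * -q.2.2.1,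
          -q.2.2.2 + q.2.1 * q.2.2.1) : ℝ × ℝ × ℝ × ℝ)) := by fun_prop
    exact h.contMDiff

end BoostHeis

end LorentzHeis

/-! Let X = ∂_x, Y = ∂_y + x ∂_z, Z = ∂_z be the left-invariant frame, whose only non-trivial
bracket is [X, Y] = Z. In the model metric 2 dx dy + (dz - x dy)², X and Y are null with product 1,
and Z is a unit vector orthogonal to both.

Normal form. If g belongs to the class, the orthogonal complement of Z in the Lie algebra is a
Lorentz plane transverse to the center, hence has a null basis (a, b). An automorphism maps X, Y to
a, b, and then Z to δ Z, where δ is the determinant of (a, b) modulo the center. Rescaling b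
balances g(a, b) against δ² g(Z, Z), so the automorphism becomes a homothety
(`exists_adapted_basis`, `exists_normalForm`). This gives (1); homotheties conjugate isometry
groups, which gives (2) and reduces (3) to the model.

Isometries of the model. Z is a unit Killing field, and ±Z are the only ones (`unit_killing`): the
Killing equations and the commutation relations give an overdetermined system that collapses once
the length is constant. An isometry therefore sends Z to ±Z, preserves dz - x dy up to sign, and
preserves or exchanges the two null lines orthogonal to Z. The commutation relations force the
factors along these lines to be constants a, b with ab = 1, and integration gives explicit formulas
(`isometry_classification`). Connectedness rules out the exchange and negative a, b, leaving ℝ ⋉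
Heis (`range_boostAction`).

The geometry. The isotropy consists of the boosts diag(e^t, e^{-t}, 1), which no Riemannian metric
allows. For maximality, the Lorentz metric preserved by a larger group G' need not be the given one.
However, its invariance under G alone makes it left-invariant and positive on the center
(`leftInvariant_of_preserves`, `centerPositive_of_preserves`), so G' is conjugate into the
isometries of the model. There an isometry fixing two suitable points is the identity, and the
images of these points depend infinitesimally on four parameters, so dim G' ≤ 4
(`dim_le_of_isometric_action`). -/

namespace LorentzHeis

/-! ### Calculus in the left-invariant frame, and unit Killing fields of the model. -/

section Frame

/-- The derivative of `u` along the left-invariant field `∂_x`. -/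
noncomputable def derivX (u : ℝ × ℝ × ℝ → ℝ) (p : ℝ × ℝ × ℝ) : ℝ := fderiv ℝ u p (1, 0, 0)

/-- The derivative of `u` along the left-invariant field `∂_y + x ∂_z`. -/
noncomputable def derivY (u : ℝ × ℝ × ℝ → ℝ) (p : ℝ × ℝ × ℝ) : ℝ := fderiv ℝ u p (0, 1, p.1)

/-- The derivative of `u` along the left-invariant field `∂_z`. -/
noncomputable def derivZ (u : ℝ × ℝ × ℝ → ℝ) (p : ℝ × ℝ × ℝ) : ℝ := fderiv ℝ u p (0, 0, 1)

variable {u v w : ℝ × ℝ × ℝ → ℝ}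

theorem fderiv_eq_frame (u : ℝ × ℝ × ℝ → ℝ) (p a : ℝ × ℝ × ℝ) :
    fderiv ℝ u p a = a.1 * derivX u p + a.2.1 * derivY u p + (a.2.2 - p.1 * a.2.1) * derivZ u p := by
  have h : a = a.1 • ((1, 0, 0) : ℝ × ℝ × ℝ) + a.2.1 • ((0, 1, p.1) : ℝ × ℝ × ℝ) +
      (a.2.2 - p.1 * a.2.1) • ((0, 0, 1) : ℝ × ℝ × ℝ) := by
    refine Prod.ext ?_ (Prod.ext ?_ ?_) <;> simp
    ring
  conv_lhs => rw [h]
  simp only [map_add, map_smul, smul_eq_mul, derivX, derivY, derivZ]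

theorem contDiff_fderiv_apply (hu : ContDiff ℝ ∞ u) {V : ℝ × ℝ × ℝ → ℝ × ℝ × ℝ}
    (hV : ContDiff ℝ ∞ V) : ContDiff ℝ ∞ (fun p ↦ fderiv ℝ u p (V p)) :=
  (hu.fderiv_right (by simp)).clm_apply hV

theorem contDiff_frameY : ContDiff ℝ ∞ (fun p : ℝ × ℝ × ℝ ↦ ((0, 1, p.1) : ℝ × ℝ × ℝ)) := by
  fun_prop

theorem _root_.ContDiff.derivX (hu : ContDiff ℝ ∞ u) : ContDiff ℝ ∞ (derivX u) :=
  contDiff_fderiv_apply hu contDiff_const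

theorem _root_.ContDiff.derivY (hu : ContDiff ℝ ∞ u) : ContDiff ℝ ∞ (derivY u) :=
  contDiff_fderiv_apply hu contDiff_frameY

theorem _root_.ContDiff.derivZ (hu : ContDiff ℝ ∞ u) : ContDiff ℝ ∞ (derivZ u) :=
  contDiff_fderiv_apply hu contDiff_const

/-- Symmetry of the second derivative cancels the Hessian terms, leaving the derivative along the
Lie bracket of V and W. The commutation relations of the frame are special cases. -/
theorem fderiv_commutator (hu : ContDiff ℝ ∞ u) {V W : ℝ × ℝ × ℝ → ℝ × ℝ × ℝ}
    (hV : ContDiff ℝ ∞ V) (hW : ContDiff ℝ ∞ W) (p : ℝ × ℝ × ℝ) :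
    fderiv ℝ (fun q ↦ fderiv ℝ u q (W q)) p (V p) - fderiv ℝ (fun q ↦ fderiv ℝ u q (V q)) p (W p) =
      fderiv ℝ u p (fderiv ℝ W p (V p) - fderiv ℝ V p (W p)) := by
  have hd : DifferentiableAt ℝ (fderiv ℝ u) p :=
    (hu.fderiv_right (m := ∞) (by simp)).differentiable (by simp) p
  have hV' := hV.differentiable (by simp) p
  have hW' := hW.differentiable (by simp) p
  rw [fderiv_clm_apply hd hW', fderiv_clm_apply hd hV']
  have hs : IsSymmSndFDerivAt ℝ u p := (contDiff_infty.1 hu 2).contDiffAt.isSymmSndFDerivAt (by simp)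
  simp only [add_apply, ContinuousLinearMap.comp_apply,
    ContinuousLinearMap.flip_apply, map_sub, hs (V p) (W p)]
  ring

theorem fderiv_frameY (p a : ℝ × ℝ × ℝ) :
    fderiv ℝ (fun q : ℝ × ℝ × ℝ ↦ ((0, 1, q.1) : ℝ × ℝ × ℝ)) p a = (0, 0, a.1) := by
  have h : HasFDerivAt (fun q : ℝ × ℝ × ℝ ↦ ((0, 1, q.1) : ℝ × ℝ × ℝ))
      ((0 : ℝ × ℝ × ℝ →L[ℝ] ℝ).prod ((0 : ℝ × ℝ × ℝ →L[ℝ] ℝ).prod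
        (ContinuousLinearMap.fst ℝ ℝ (ℝ × ℝ)))) p :=
    (hasFDerivAt_const _ _).prodMk ((hasFDerivAt_const _ _).prodMk hasFDerivAt_fst)
  rw [h.fderiv]
  rfl

theorem derivX_derivY (hu : ContDiff ℝ ∞ u) (p : ℝ × ℝ × ℝ) :
    derivX (derivY u) p = derivY (derivX u) p + derivZ u p := by
  have h := fderiv_commutator hu (V := fun _ ↦ (1, 0, 0)) contDiff_const contDiff_frameY p
  rw [fderiv_frameY] at h
  simp only [fderiv_fun_const, Pi.zero_apply, zero_apply, sub_zero] at h
  exact sub_eq_iff_eq_add'.1 h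

theorem derivX_derivZ (hu : ContDiff ℝ ∞ u) (p : ℝ × ℝ × ℝ) :
    derivX (derivZ u) p = derivZ (derivX u) p := by
  have h := fderiv_commutator hu (V := fun _ ↦ (1, 0, 0)) (W := fun _ ↦ (0, 0, 1)) contDiff_const
    contDiff_const p
  simp only [fderiv_fun_const, Pi.zero_apply, zero_apply, sub_zero,
    map_zero] at h
  exact sub_eq_zero.1 h

theorem derivY_derivZ (hu : ContDiff ℝ ∞ u) (p : ℝ × ℝ × ℝ) :
    derivY (derivZ u) p = derivZ (derivY u) p := by
  have h := fderiv_commutator hu (W := fun _ ↦ (0, 0, 1)) contDiff_frameY contDiff_const p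
  rw [fderiv_frameY] at h
  simp only [fderiv_fun_const, Pi.zero_apply, zero_apply, sub_zero,
    Prod.mk_zero_zero, map_zero] at h
  exact sub_eq_zero.1 h

theorem fderiv_mul_apply (hu : ContDiff ℝ ∞ u) (hv : ContDiff ℝ ∞ v) (p a : ℝ × ℝ × ℝ) :
    fderiv ℝ (fun q ↦ u q * v q) p a = fderiv ℝ u p a * v p + u p * fderiv ℝ v p a := by
  rw [fderiv_fun_mul (hu.differentiable (by simp) p) (hv.differentiable (by simp) p)]
  simp
  ring

theorem fderiv_add_apply' (hu : ContDiff ℝ ∞ u) (hv : ContDiff ℝ ∞ v) (p a : ℝ × ℝ × ℝ) :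
    fderiv ℝ (fun q ↦ u q + v q) p a = fderiv ℝ u p a + fderiv ℝ v p a := by
  rw [fderiv_fun_add (hu.differentiable (by simp) p) (hv.differentiable (by simp) p)]
  rfl

theorem fderiv_neg_apply' (p a : ℝ × ℝ × ℝ) :
    fderiv ℝ (fun q ↦ -u q) p a = -fderiv ℝ u p a := by
  rw [fderiv_fun_neg]
  rfl

theorem fderiv_eq_zero_of_const {c : ℝ} (h : ∀ p, u p = c) (p a : ℝ × ℝ × ℝ) :
    fderiv ℝ u p a = 0 := by
  obtain rfl : u = fun _ ↦ c := funext h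
  simp

theorem eq_const_of_frame (hu : ContDiff ℝ ∞ u) (hX : ∀ p, derivX u p = 0)
    (hY : ∀ p, derivY u p = 0) (hZ : ∀ p, derivZ u p = 0) (p q : ℝ × ℝ × ℝ) : u p = u q := by
  refine is_const_of_fderiv_eq_zero (𝕜 := ℝ) (hu.differentiable (by simp)) (fun p ↦ ?_) p q
  refine ContinuousLinearMap.ext fun a ↦ ?_
  simp [fderiv_eq_frame u p, hX, hY, hZ]

/-- A function with the same frame derivatives as `v` differs from `v` by a constant. -/
theorem eq_of_frame_eq (hu : ContDiff ℝ ∞ u) (hv : ContDiff ℝ ∞ v)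
    (hX : ∀ p, derivX u p = derivX v p) (hY : ∀ p, derivY u p = derivY v p)
    (hZ : ∀ p, derivZ u p = derivZ v p) (p : ℝ × ℝ × ℝ) : u p = v p + (u 0 - v 0) := by
  have h : ∀ q a, fderiv ℝ (fun q ↦ u q - v q) q a = fderiv ℝ u q a - fderiv ℝ v q a := by
    intro q a
    rw [fderiv_fun_sub (hu.differentiable (by simp) q) (hv.differentiable (by simp) q)]
    rfl
  have := eq_const_of_frame (hu.sub hv)
    (fun p ↦ (h p _).trans (sub_eq_zero.2 (hX p))) (fun p ↦ (h p _).trans (sub_eq_zero.2 (hY p)))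
    (fun p ↦ (h p _).trans (sub_eq_zero.2 (hZ p))) p 0
  linarith

/-- Unit Killing fields `u X + v Y + w Z` of the metric `2 dx dy + (dz - x dy)²` are `± Z`. -/
theorem unit_killing (hu : ContDiff ℝ ∞ u) (hv : ContDiff ℝ ∞ v) (hw : ContDiff ℝ ∞ w)
    (hXv : ∀ p, derivX v p = 0) (hYu : ∀ p, derivY u p = 0) (hZw : ∀ p, derivZ w p = 0)
    (hXY : ∀ p, derivX u p + derivY v p = 0)
    (hXZ : ∀ p, derivZ v p + derivX w p + v p = 0)
    (hYZ : ∀ p, derivZ u p + derivY w p - u p = 0)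
    (hunit : ∀ p, 2 * (u p * v p) + w p * w p = 1) :
    (∀ p, u p = 0) ∧ (∀ p, v p = 0) ∧ ∃ ε : ℝ, ε * ε = 1 ∧ ∀ p, w p = ε := by
  -- Put s = Xu = -Yv. The commutation relations give Xs = -Zv and Ys = -Zu.
  have hs : derivX u = fun p ↦ -derivY v p := funext fun p ↦ by linarith [hXY p]
  have hXs : ∀ p, derivX (derivX u) p = -derivZ v p := fun p ↦ by
    conv_lhs => rw [hs]
    unfold derivX
    rw [fderiv_neg_apply']
    have h1 := derivX_derivY hv p
    have h2 : derivY (derivX v) p = 0 := fderiv_eq_zero_of_const hXv p _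
    unfold derivX at h1 h2
    linarith
  have hYs : ∀ p, derivY (derivX u) p = -derivZ u p := fun p ↦ by
    have h1 := derivX_derivY hu p
    have h2 : derivX (derivY u) p = 0 := fderiv_eq_zero_of_const hYu p _
    linarith
  have hZs' : ∀ p, derivZ (derivX u) p = -derivZ (derivY v) p := fun p ↦ by
    conv_lhs => rw [hs]
    exact fderiv_neg_apply' p _
  -- Zs = XYs - YXs = -ZXu + ZYv = -2 Zs, hence Zs = 0.
  have hZs : ∀ p, derivZ (derivX u) p = 0 := fun p ↦ by
    have h1 := derivX_derivY hu.derivX p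
    rw [show derivY (derivX u) = fun p ↦ -derivZ u p from funext hYs,
      show derivX (derivX u) = fun p ↦ -derivZ v p from funext hXs] at h1
    have h2 : derivX (fun p ↦ -derivZ u p) p = -derivX (derivZ u) p := fderiv_neg_apply' p _
    have h3 : derivY (fun p ↦ -derivZ v p) p = -derivY (derivZ v) p := fderiv_neg_apply' p _
    rw [h2, h3, derivX_derivZ hu, derivY_derivZ hv] at h1
    linarith [hZs' p]
  have hZX : ∀ p, derivX (derivZ w) p = 0 := fun p ↦ fderiv_eq_zero_of_const hZw p _
  have hZY : ∀ p, derivY (derivZ w) p = 0 := fun p ↦ fderiv_eq_zero_of_const hZw p _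
  -- Zv is killed by X and Y, hence by Z = [X, Y]. Differentiating `hXZ` along Z, where ZXw = XZw =
  -- 0, then leaves Zv = 0. The argument for Zu is the same.
  have hZv : ∀ p, derivZ v p = 0 := fun p ↦ by
    have a1 : ∀ p, derivX (derivZ v) p = 0 := fun p ↦ by
      rw [derivX_derivZ hv]; exact fderiv_eq_zero_of_const hXv p _
    have a2 : ∀ p, derivY (derivZ v) p = 0 := fun p ↦ by
      rw [derivY_derivZ hv]; linarith [hZs p, hZs' p]
    have a3 : derivZ (derivZ v) p = 0 := by
      have := derivX_derivY hv.derivZ p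
      have b1 : derivX (derivY (derivZ v)) p = 0 := fderiv_eq_zero_of_const a2 p _
      have b2 : derivY (derivX (derivZ v)) p = 0 := fderiv_eq_zero_of_const a1 p _
      linarith
    have a4 : fderiv ℝ (fun p ↦ derivZ v p + derivX w p + v p) p (0, 0, 1) = 0 :=
      fderiv_eq_zero_of_const hXZ p _
    rw [fderiv_add_apply' (hv.derivZ.add hw.derivX) hv, fderiv_add_apply' hv.derivZ hw.derivX] at a4
    change derivZ (derivZ v) p + derivZ (derivX w) p + derivZ v p = 0 at a4
    linarith [derivX_derivZ hw p, hZX p]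
  have hZu : ∀ p, derivZ u p = 0 := fun p ↦ by
    have a1 : ∀ p, derivX (derivZ u) p = 0 := fun p ↦ by
      rw [derivX_derivZ hu]; exact hZs p
    have a2 : ∀ p, derivY (derivZ u) p = 0 := fun p ↦ by
      rw [derivY_derivZ hu]; exact fderiv_eq_zero_of_const hYu p _
    have a3 : derivZ (derivZ u) p = 0 := by
      have := derivX_derivY hu.derivZ p
      have b1 : derivX (derivY (derivZ u)) p = 0 := fderiv_eq_zero_of_const a2 p _
      have b2 : derivY (derivX (derivZ u)) p = 0 := fderiv_eq_zero_of_const a1 p _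
      linarith
    have a4 : fderiv ℝ (fun p ↦ derivZ u p + derivY w p + -u p) p (0, 0, 1) = 0 :=
      fderiv_eq_zero_of_const (c := 0) (fun p ↦ by linarith [hYZ p]) p _
    rw [fderiv_add_apply' (hu.derivZ.add hw.derivY) hu.neg, fderiv_add_apply' hu.derivZ hw.derivY,
      fderiv_neg_apply'] at a4
    change derivZ (derivZ u) p + derivZ (derivY w) p + -derivZ u p = 0 at a4
    linarith [derivY_derivZ hw p, hZY p]
  have hXw : ∀ p, derivX w p = -v p := fun p ↦ by linarith [hXZ p, hZv p]
  have hYw : ∀ p, derivY w p = u p := fun p ↦ by linarith [hYZ p, hZu p]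
  have hD : ∀ p a, 2 * (fderiv ℝ u p a * v p + u p * fderiv ℝ v p a) +
      2 * (w p * fderiv ℝ w p a) = 0 := fun p a ↦ by
    have a4 : fderiv ℝ (fun p ↦ u p * v p + u p * v p + w p * w p) p a = 0 :=
      fderiv_eq_zero_of_const (c := 1) (fun p ↦ by linarith [hunit p]) p _
    rw [fderiv_add_apply' ((hu.mul hv).add (hu.mul hv)) (hw.mul hw),
      fderiv_add_apply' (hu.mul hv) (hu.mul hv), fderiv_mul_apply hu hv,
      fderiv_mul_apply hw hw] at a4
    linarith
  -- Differentiating the unit condition along X gives sv = wv. A second derivative along X, with Xs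
  -- = -Zv = 0 and Xw = -v, leaves v² = 0. For u, the field Y plays the role of X.
  have hv0 : ∀ p, v p = 0 := fun p ↦ by
    have a1 : ∀ p, derivX u p * v p + -(w p * v p) = 0 := fun p ↦ by
      have := hD p (1, 0, 0)
      change 2 * (derivX u p * v p + u p * derivX v p) + 2 * (w p * derivX w p) = 0 at this
      rw [hXv, hXw] at this
      linarith
    have a2 : fderiv ℝ (fun p ↦ derivX u p * v p + -(w p * v p)) p (1, 0, 0) = 0 :=
      fderiv_eq_zero_of_const a1 p _
    rw [fderiv_add_apply' (hu.derivX.mul hv) (hw.mul hv).neg, fderiv_neg_apply',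
      fderiv_mul_apply hu.derivX hv, fderiv_mul_apply hw hv] at a2
    change derivX (derivX u) p * v p + derivX u p * derivX v p +
      -(derivX w p * v p + w p * derivX v p) = 0 at a2
    rw [hXs, hXv, hXw, hZv] at a2
    nlinarith
  have hu0 : ∀ p, u p = 0 := fun p ↦ by
    have a1 : ∀ p, -(derivX u p * u p) + w p * u p = 0 := fun p ↦ by
      have := hD p (0, 1, p.1)
      change 2 * (derivY u p * v p + u p * derivY v p) + 2 * (w p * derivY w p) = 0 at this
      rw [hYu, hYw, show derivY v p = -derivX u p by linarith [hXY p]] at this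
      linarith
    have a2 : fderiv ℝ (fun p ↦ -(derivX u p * u p) + w p * u p) p (0, 1, p.1) = 0 :=
      fderiv_eq_zero_of_const a1 p _
    rw [fderiv_add_apply' (hu.derivX.mul hu).neg (hw.mul hu), fderiv_neg_apply',
      fderiv_mul_apply hu.derivX hu, fderiv_mul_apply hw hu] at a2
    change -(derivY (derivX u) p * u p + derivX u p * derivY u p) +
      (derivY w p * u p + w p * derivY u p) = 0 at a2
    rw [hYs, hYu, hYw, hZu] at a2
    nlinarith
  refine ⟨hu0, hv0, w 0, ?_, fun p ↦ eq_const_of_frame hw (fun p ↦ ?_) (fun p ↦ ?_) hZw p 0⟩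
  · have := hunit 0
    rw [hu0] at this
    linarith
  · rw [hXw, hv0, neg_zero]
  · rw [hYw, hu0]

end Frame

/-! ### Isometries of the model metric. -/

section Model

/-- The metric `2 dx dy + (dz - x dy)²` on `ℝ³`. -/
def modelForm (p v w : ℝ × ℝ × ℝ) : ℝ :=
  v.1 * w.2.1 + v.2.1 * w.1 + (v.2.2 - p.1 * v.2.1) * (w.2.2 - p.1 * w.2.1)

/-- Equality of mixed partial derivatives: differentiation in the parameter turns the spatial
differential of the family into the differential of its velocity field. -/
theorem hasDerivAt_variation {E F : Type*} [NormedAddCommGroup E] [NormedSpace ℝ E]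
    [NormedAddCommGroup F] [NormedSpace ℝ F] {Ψ : ℝ × E → F} (hΨ : ContDiff ℝ ∞ Ψ) (p a : E) :
    HasDerivAt (fun s ↦ fderiv ℝ Ψ (s, p) (0, a))
      (fderiv ℝ (fun q ↦ fderiv ℝ Ψ (0, q) (1, 0)) p a) 0 := by
  have hD : HasFDerivAt (fderiv ℝ Ψ) (fderiv ℝ (fderiv ℝ Ψ) (0, p)) (0, p) :=
    ((hΨ.fderiv_right (m := ∞) (by simp)).differentiable (by simp) _).hasFDerivAt
  have hsymm : IsSymmSndFDerivAt ℝ Ψ (0, p) :=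
    (contDiff_infty.1 hΨ 2).contDiffAt.isSymmSndFDerivAt (by simp)
  have hline : HasDerivAt (fun s : ℝ ↦ (s, p)) ((1, 0) : ℝ × E) 0 :=
    (hasDerivAt_id _).prodMk (hasDerivAt_const _ _)
  have h2 : HasFDerivAt (fun q : E ↦ ((0 : ℝ), q)) (ContinuousLinearMap.inr ℝ ℝ E) p :=
    hasFDerivAt_prodMk_right _ _
  have h3 : HasFDerivAt (fun q ↦ fderiv ℝ Ψ (0, q) (1, 0))
      ((((fderiv ℝ (fderiv ℝ Ψ) (0, p)).comp (ContinuousLinearMap.inr ℝ ℝ E))).flip (1, 0)) p := by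
    have := (hD.comp p h2).clm_apply (hasFDerivAt_const ((1 : ℝ), (0 : E)) p)
    rwa [ContinuousLinearMap.comp_zero, zero_add] at this
  have h4 : HasDerivAt (fun s ↦ fderiv ℝ Ψ (s, p) (0, a))
      (fderiv ℝ (fderiv ℝ Ψ) (0, p) (1, 0) (0, a)) 0 := by
    have h5 : HasDerivAt (fun s ↦ fderiv ℝ Ψ (s, p)) (fderiv ℝ (fderiv ℝ Ψ) (0, p) (1, 0)) 0 :=
      HasFDerivAt.comp_hasDerivAt (0 : ℝ) (f := fun s ↦ (s, p)) hD hline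
    exact (ContinuousLinearMap.apply ℝ F ((0 : ℝ), a)).hasFDerivAt.comp_hasDerivAt (0 : ℝ) h5
  rw [h3.fderiv]
  exact h4.congr_deriv (hsymm (1, 0) (0, a))

/-- The derivative at `0` of a smooth family of isometries starting at the identity satisfies the
Killing equation. -/
theorem killing_of_family {Ψ : ℝ × (ℝ × ℝ × ℝ) → ℝ × ℝ × ℝ} (hΨ : ContDiff ℝ ∞ Ψ)
    (h0 : ∀ p, Ψ (0, p) = p)
    (hiso : ∀ s p v w, modelForm (Ψ (s, p)) (fderiv ℝ Ψ (s, p) (0, v)) (fderiv ℝ Ψ (s, p) (0, w)) =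
      modelForm p v w)
    {n : ℝ × ℝ × ℝ → ℝ × ℝ × ℝ} (hn : ∀ p, n p = fderiv ℝ Ψ (0, p) (1, 0)) (p v w : ℝ × ℝ × ℝ) :
    (fderiv ℝ n p v).1 * w.2.1 + v.1 * (fderiv ℝ n p w).2.1 + ((fderiv ℝ n p v).2.1 * w.1 +
      v.2.1 * (fderiv ℝ n p w).1) +
      (((fderiv ℝ n p v).2.2 - ((n p).1 * v.2.1 + p.1 * (fderiv ℝ n p v).2.1)) *
        (w.2.2 - p.1 * w.2.1) + (v.2.2 - p.1 * v.2.1) *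
        ((fderiv ℝ n p w).2.2 - ((n p).1 * w.2.1 + p.1 * (fderiv ℝ n p w).2.1))) = 0 := by
  have hline : HasDerivAt (fun s : ℝ ↦ (s, p)) ((1, 0) : ℝ × (ℝ × ℝ × ℝ)) 0 :=
    (hasDerivAt_id _).prodMk (hasDerivAt_const _ _)
  have hΨ0 : HasDerivAt (fun s ↦ Ψ (s, p)) (n p) 0 := by
    rw [hn]
    exact ((hΨ.differentiable (by simp) (0, p)).hasFDerivAt).comp_hasDerivAt (0 : ℝ) hline
  have hvar : ∀ a : ℝ × ℝ × ℝ,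
      HasDerivAt (fun s ↦ fderiv ℝ Ψ (s, p) (0, a)) (fderiv ℝ n p a) 0 := fun a ↦ by
    rw [show n = fun q ↦ fderiv ℝ Ψ (0, q) (1, 0) from funext hn]
    exact hasDerivAt_variation hΨ p a
  have c : ∀ (L : ℝ × ℝ × ℝ →L[ℝ] ℝ) {φ : ℝ → ℝ × ℝ × ℝ} {φ'}, HasDerivAt φ φ' 0 →
      HasDerivAt (fun s ↦ L (φ s)) (L φ') 0 := fun L _ _ h ↦
    L.hasFDerivAt.comp_hasDerivAt (0 : ℝ) h
  have c1 : ∀ {φ : ℝ → ℝ × ℝ × ℝ} {φ'}, HasDerivAt φ φ' 0 →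
      HasDerivAt (fun s ↦ (φ s).1) φ'.1 0 := fun h ↦ c (.fst ℝ ℝ (ℝ × ℝ)) h
  have c2 : ∀ {φ : ℝ → ℝ × ℝ × ℝ} {φ'}, HasDerivAt φ φ' 0 →
      HasDerivAt (fun s ↦ (φ s).2.1) φ'.2.1 0 := fun h ↦
    c ((ContinuousLinearMap.fst ℝ ℝ ℝ).comp (.snd ℝ ℝ (ℝ × ℝ))) h
  have c3 : ∀ {φ : ℝ → ℝ × ℝ × ℝ} {φ'}, HasDerivAt φ φ' 0 →
      HasDerivAt (fun s ↦ (φ s).2.2) φ'.2.2 0 := fun h ↦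
    c ((ContinuousLinearMap.snd ℝ ℝ ℝ).comp (.snd ℝ ℝ (ℝ × ℝ))) h
  have hv := hvar v
  have hw := hvar w
  have key := (((c1 hv).mul (c2 hw)).add ((c2 hv).mul (c1 hw))).add
    (((c3 hv).sub ((c1 hΨ0).mul (c2 hv))).mul ((c3 hw).sub ((c1 hΨ0).mul (c2 hw))))
  have hconst : HasDerivAt (fun s ↦ modelForm (Ψ (s, p)) (fderiv ℝ Ψ (s, p) (0, v))
      (fderiv ℝ Ψ (s, p) (0, w))) 0 0 := by
    simp only [hiso]
    exact hasDerivAt_const _ _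
  have hid : ∀ a, fderiv ℝ Ψ (0, p) (0, a) = a := by
    intro a
    have h2 : HasFDerivAt (fun q : ℝ × ℝ × ℝ ↦ ((0 : ℝ), q))
      (ContinuousLinearMap.inr ℝ ℝ (ℝ × ℝ × ℝ)) p := hasFDerivAt_prodMk_right _ _
    have h3 := (hΨ.differentiable (by simp) (0, p)).hasFDerivAt.comp p h2
    have h4 : (Ψ ∘ fun q : ℝ × ℝ × ℝ ↦ ((0 : ℝ), q)) = id := funext h0
    rw [h4] at h3
    have := congrArg (fun L : ℝ × ℝ × ℝ →L[ℝ] ℝ × ℝ × ℝ ↦ L a) (h3.unique (hasFDerivAt_id p))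
    simpa using this
  have := key.unique hconst
  simp only [hid, h0, Pi.sub_apply, Pi.mul_apply] at this
  exact this

/-- Smooth isometries of the model metric map the central field `∂_z` to `± ∂_z`. -/
theorem fderiv_center_of_isometry {f g : ℝ × ℝ × ℝ → ℝ × ℝ × ℝ} (hf : ContDiff ℝ ∞ f)
    (hg : ContDiff ℝ ∞ g) (hfg : ∀ p, f (g p) = p) (hgf : ∀ p, g (f p) = p)
    (hiso : ∀ p v w, modelForm (f p) (fderiv ℝ f p v) (fderiv ℝ f p w) = modelForm p v w) :
    ∃ ε : ℝ, ε * ε = 1 ∧ ∀ p, fderiv ℝ f p (0, 0, 1) = (0, 0, ε) := by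
  -- T(s, ·) is g followed by the flow of Z, so f ∘ T is the flow of the image field f_* Z, whose
  -- velocity is n below.
  let T : ℝ × (ℝ × ℝ × ℝ) → ℝ × ℝ × ℝ := fun q ↦ g q.2 + q.1 • (0, 0, 1)
  have hT : ContDiff ℝ ∞ T := (hg.comp contDiff_snd).add (contDiff_fst.smul contDiff_const)
  have hT' : ∀ q a, fderiv ℝ T q a = fderiv ℝ g q.2 a.2 + a.1 • (0, 0, 1) := by
    intro q a
    have h1 : HasFDerivAt (fun q : ℝ × (ℝ × ℝ × ℝ) ↦ g q.2)
        ((fderiv ℝ g q.2).comp (ContinuousLinearMap.snd ℝ ℝ (ℝ × ℝ × ℝ))) q :=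
      (hg.differentiable (by simp) _).hasFDerivAt.comp q hasFDerivAt_snd
    have h2 : HasFDerivAt (fun q : ℝ × (ℝ × ℝ × ℝ) ↦ q.1 • ((0, 0, 1) : ℝ × ℝ × ℝ))
      ((ContinuousLinearMap.fst ℝ ℝ (ℝ × ℝ × ℝ)).smulRight ((0, 0, 1) : ℝ × ℝ × ℝ)) q :=
      hasFDerivAt_fst.smul_const _
    exact congrArg (fun L : ℝ × (ℝ × ℝ × ℝ) →L[ℝ] ℝ × ℝ × ℝ ↦ L a) (h1.add h2).fderiv
  have hT0 : ∀ p, T (0, p) = g p := fun p ↦ by simp only [T, zero_smul, add_zero]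
  have hΨ : ContDiff ℝ ∞ (f ∘ T) := hf.comp hT
  have hΨ' : ∀ q a, fderiv ℝ (f ∘ T) q a = fderiv ℝ f (T q) (fderiv ℝ g q.2 a.2 + a.1 • (0, 0, 1)) := by
    intro q a
    rw [fderiv_comp _ (hf.differentiable (by simp) _) (hT.differentiable (by simp) _), ← hT']
    rfl
  have hfg' : ∀ p a, fderiv ℝ f (g p) (fderiv ℝ g p a) = a := by
    intro p a
    have h1 := (hf.differentiable (by simp) _).hasFDerivAt.comp p
      (hg.differentiable (by simp) p).hasFDerivAt
    rw [show f ∘ g = id from funext hfg] at h1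
    exact congrArg (fun L : ℝ × ℝ × ℝ →L[ℝ] ℝ × ℝ × ℝ ↦ L a) (h1.unique (hasFDerivAt_id p))
  let n : ℝ × ℝ × ℝ → ℝ × ℝ × ℝ := fun p ↦ fderiv ℝ f (g p) (0, 0, 1)
  have hns : ContDiff ℝ ∞ n :=
    ((hf.fderiv_right (by simp)).comp hg).clm_apply contDiff_const
  have hn : ∀ p, n p = fderiv ℝ (f ∘ T) (0, p) (1, 0) := by
    intro p
    rw [hΨ', hT0]
    simp [n]
  have hK := killing_of_family hΨ (fun p ↦ by rw [Function.comp_apply, hT0, hfg]) (fun s p v w ↦ by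
    rw [hΨ', hΨ', Function.comp_apply, hiso]
    -- The coefficients of the metric depend on x only, so translation along z is isometric.
    have e : ∀ a b, modelForm (T (s, p)) a b = modelForm (g p) a b := by
      intro a b
      simp [T, modelForm]
    rw [e, zero_smul, add_zero, add_zero, ← hiso, hfg, hfg', hfg']) hn
  have d1 : ∀ p a, fderiv ℝ (fun q ↦ (n q).1) p a = (fderiv ℝ n p a).1 := fun p a ↦ by
    rw [fderiv.fst (hns.differentiable (by simp) p)]; rfl
  have hn2 : ContDiff ℝ ∞ (fun q ↦ (n q).2) := contDiff_snd.comp hns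
  have d2 : ∀ p a, fderiv ℝ (fun q ↦ (n q).2.1) p a = (fderiv ℝ n p a).2.1 := fun p a ↦ by
    rw [fderiv.fst (hn2.differentiable (by simp) p), fderiv.snd (hns.differentiable (by simp) p)]
    rfl
  have d3 : ∀ p a, fderiv ℝ (fun q ↦ (n q).2.2) p a = (fderiv ℝ n p a).2.2 := fun p a ↦ by
    rw [fderiv.snd (hn2.differentiable (by simp) p), fderiv.snd (hns.differentiable (by simp) p)]
    rfl
  have s1 : ContDiff ℝ ∞ (fun q ↦ (n q).1) := contDiff_fst.comp hns
  have s2 : ContDiff ℝ ∞ (fun q ↦ (n q).2.1) := contDiff_fst.comp hn2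
  have s3 : ContDiff ℝ ∞ (fun q ↦ (n q).2.2) := contDiff_snd.comp hn2
  have s4 : ContDiff ℝ ∞ (fun q : ℝ × ℝ × ℝ ↦ -(q.1 * (n q).2.1)) := (contDiff_fst.mul s2).neg
  have d4 : ∀ p a, fderiv ℝ (fun q ↦ (n q).2.2 + -(q.1 * (n q).2.1)) p a =
      (fderiv ℝ n p a).2.2 + -(a.1 * (n p).2.1 + p.1 * (fderiv ℝ n p a).2.1) := fun p a ↦ by
    rw [fderiv_add_apply' s3 s4, fderiv_neg_apply', fderiv_mul_apply contDiff_fst s2, d3, d2,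
      fderiv_fst]
    rfl
  have hunit : ∀ p, modelForm p (n p) (n p) = 1 := fun p ↦ by
    have := hiso (g p) (0, 0, 1) (0, 0, 1)
    rw [hfg] at this
    refine this.trans ?_
    simp [modelForm]
  -- The frame components of n are n₁, n₂ and n₃ - x n₂. Their six equations are `hK` on the pairs
  -- XX, YY, ZZ, XY, XZ, YZ.
  obtain ⟨h1, h2, ε, hε, h3⟩ := unit_killing s1 s2 (s3.add s4)
    (fun p ↦ by
      have := hK p (1, 0, 0) (1, 0, 0)
      simp only [derivX, d2] at this ⊢
      linarith)
    (fun p ↦ by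
      have := hK p (0, 1, p.1) (0, 1, p.1)
      simp only [derivY, d1] at this ⊢
      linarith)
    (fun p ↦ by
      have := hK p (0, 0, 1) (0, 0, 1)
      simp only [derivZ, d4] at this ⊢
      linarith)
    (fun p ↦ by
      have := hK p (1, 0, 0) (0, 1, p.1)
      simp only [derivX, derivY, d1, d2] at this ⊢
      linarith)
    (fun p ↦ by
      have := hK p (1, 0, 0) (0, 0, 1)
      simp only [derivX, derivZ, d2, d4] at this ⊢
      linarith)
    (fun p ↦ by
      have := hK p (0, 1, p.1) (0, 0, 1)
      simp only [derivY, derivZ, d1, d4] at this ⊢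
      linarith)
    (fun p ↦ by
      have := hunit p
      simp only [modelForm] at this
      linarith)
  refine ⟨ε, hε, fun p ↦ ?_⟩
  have e : fderiv ℝ f p (0, 0, 1) = n (f p) := by simp only [n, hgf]
  rw [e]
  refine Prod.ext (h1 _) (Prod.ext (h2 _) ?_)
  have := h3 (f p)
  rw [h2] at this
  simpa using this

/-- The isometries of the model metric: affine boosts, and their compositions with the automorphism
which exchanges the two null directions. -/
theorem isometry_classification {f g : ℝ × ℝ × ℝ → ℝ × ℝ × ℝ} (hf : ContDiff ℝ ∞ f)
    (hg : ContDiff ℝ ∞ g) (hfg : ∀ p, f (g p) = p) (hgf : ∀ p, g (f p) = p)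
    (hiso : ∀ p v w, modelForm (f p) (fderiv ℝ f p v) (fderiv ℝ f p w) = modelForm p v w) :
    ∃ (h : ℝ × ℝ × ℝ) (a b : ℝ), a * b = 1 ∧
      ((∀ p, f p = (h.1 + a * p.1, h.2.1 + b * p.2.1, h.2.2 + p.2.2 + h.1 * (b * p.2.1))) ∨
      (∀ p, f p = (h.1 + a * p.2.1, h.2.1 + b * p.1,
        h.2.2 + (p.1 * p.2.1 - p.2.2) + h.1 * (b * p.1)))) := by
  obtain ⟨ε, hε, hZ⟩ := fderiv_center_of_isometry hf hg hfg hgf hiso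
  have hf2 : ContDiff ℝ ∞ (fun q ↦ (f q).2) := contDiff_snd.comp hf
  have d1 : ∀ p a, fderiv ℝ (fun q ↦ (f q).1) p a = (fderiv ℝ f p a).1 := fun p a ↦ by
    rw [fderiv.fst (hf.differentiable (by simp) p)]; rfl
  have d2 : ∀ p a, fderiv ℝ (fun q ↦ (f q).2.1) p a = (fderiv ℝ f p a).2.1 := fun p a ↦ by
    rw [fderiv.fst (hf2.differentiable (by simp) p), fderiv.snd (hf.differentiable (by simp) p)]
    rfl
  have d3 : ∀ p a, fderiv ℝ (fun q ↦ (f q).2.2) p a = (fderiv ℝ f p a).2.2 := fun p a ↦ by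
    rw [fderiv.snd (hf2.differentiable (by simp) p), fderiv.snd (hf.differentiable (by simp) p)]
    rfl
  have s1 : ContDiff ℝ ∞ (fun q ↦ (f q).1) := contDiff_fst.comp hf
  have s2 : ContDiff ℝ ∞ (fun q ↦ (f q).2.1) := contDiff_fst.comp hf2
  have s3 : ContDiff ℝ ∞ (fun q ↦ (f q).2.2) := contDiff_snd.comp hf2
  generalize hu : (fun q ↦ (f q).1) = u at *
  generalize hv : (fun q ↦ (f q).2.1) = v at *
  generalize hw : (fun q ↦ (f q).2.2) = w at *
  have eu : ∀ q, (f q).1 = u q := fun q ↦ congrFun hu q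
  have ev : ∀ q, (f q).2.1 = v q := fun q ↦ congrFun hv q
  have ew : ∀ q, (f q).2.2 = w q := fun q ↦ congrFun hw q
  have hZu : ∀ p, derivZ u p = 0 := fun p ↦ by rw [derivZ, d1, hZ]
  have hZv : ∀ p, derivZ v p = 0 := fun p ↦ by rw [derivZ, d2, hZ]
  have hZw : ∀ p, derivZ w p = ε := fun p ↦ by rw [derivZ, d3, hZ]
  have hε0 : ε ≠ 0 := by rintro rfl; simp at hε
  -- X is orthogonal to Z, so its image is orthogonal to εZ, that is, annihilated by dz - x dy. The
  -- same holds for Y.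
  have hXw : ∀ p, derivX w p = u p * derivX v p := fun p ↦ by
    have := hiso p (1, 0, 0) (0, 0, 1)
    rw [hZ] at this
    simp only [modelForm, eu, ← d1, ← d2, ← d3] at this
    unfold derivX
    have h0 : (fderiv ℝ w p (1, 0, 0) - u p * fderiv ℝ v p (1, 0, 0)) * ε = 0 := by linarith
    linarith [(mul_eq_zero.1 h0).resolve_right hε0]
  have hYw : ∀ p, derivY w p = u p * derivY v p := fun p ↦ by
    have := hiso p (0, 1, p.1) (0, 0, 1)
    rw [hZ] at this
    simp only [modelForm, eu, ← d1, ← d2, ← d3] at this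
    unfold derivY
    have h0 : (fderiv ℝ w p (0, 1, p.1) - u p * fderiv ℝ v p (0, 1, p.1)) * ε = 0 := by linarith
    linarith [(mul_eq_zero.1 h0).resolve_right hε0]
  have hXX : ∀ p, derivX u p * derivX v p = 0 := fun p ↦ by
    have := hiso p (1, 0, 0) (1, 0, 0)
    simp only [modelForm, eu, ← d1, ← d2, ← d3] at this
    have h0 := hXw p
    unfold derivX at h0 ⊢
    rw [h0] at this
    linarith
  have hYY : ∀ p, derivY u p * derivY v p = 0 := fun p ↦ by
    have := hiso p (0, 1, p.1) (0, 1, p.1)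
    simp only [modelForm, eu, ← d1, ← d2, ← d3] at this
    have h0 := hYw p
    unfold derivY at h0 ⊢
    rw [h0] at this
    linarith
  have hsum : ∀ p, derivX u p * derivY v p + derivX v p * derivY u p = 1 := fun p ↦ by
    have := hiso p (1, 0, 0) (0, 1, p.1)
    simp only [modelForm, eu, ← d1, ← d2, ← d3] at this
    have h0 := hYw p
    unfold derivX
    unfold derivY at h0 ⊢
    rw [h0] at this
    linarith
  -- Applying Z = [X, Y] to w, with Xw = u Xv and Yw = u Yv, identifies the Jacobian of (u, v) along
  -- X, Y with Zw = ε.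
  have hdiff : ∀ p, derivX u p * derivY v p - derivY u p * derivX v p = ε := fun p ↦ by
    have h1 := derivX_derivY s3 p
    rw [show derivX w = fun p ↦ u p * derivX v p from funext hXw,
      show derivY w = fun p ↦ u p * derivY v p from funext hYw, hZw] at h1
    have h2 : derivX (fun p ↦ u p * derivY v p) p =
      derivX u p * derivY v p + u p * derivX (derivY v) p := fderiv_mul_apply s1 s2.derivY _ _
    have h3 : derivY (fun p ↦ u p * derivX v p) p =
      derivY u p * derivX v p + u p * derivY (derivX v) p := fderiv_mul_apply s1 s2.derivX _ _
    rw [h2, h3, derivX_derivY s2, hZv] at h1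
    linarith
  have lin : ∀ {φ ψ : ℝ × ℝ × ℝ → ℝ}, ContDiff ℝ ∞ φ → ContDiff ℝ ∞ ψ →
      (∀ p a, fderiv ℝ φ p a = a.1 * derivX ψ p + a.2.1 * derivY ψ p +
        (a.2.2 - p.1 * a.2.1) * derivZ ψ p) → ∀ p, ψ p = φ p + (ψ 0 - φ 0) := by
    intro φ ψ hφ hψ h
    refine eq_of_frame_eq hψ hφ (fun p ↦ ?_) (fun p ↦ ?_) (fun p ↦ ?_)
    · simp [derivX, h]
    · simp [derivY, h]
    · simp [derivZ, h]
  -- Commutators give YXφ = ZXφ = 0 and XYψ = 0; differentiating Xφ · Yψ = 1 along X then gives XXφ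
  -- = 0. So Xφ is constant, and with it Yψ.
  have constant : ∀ {φ ψ : ℝ × ℝ × ℝ → ℝ}, ContDiff ℝ ∞ φ → ContDiff ℝ ∞ ψ →
      (∀ p, derivX φ p * derivY ψ p = 1) → (∀ p, derivY φ p = 0) → (∀ p, derivX ψ p = 0) →
      (∀ p, derivZ φ p = 0) → (∀ p, derivZ ψ p = 0) →
      ∃ a b : ℝ, a * b = 1 ∧ (∀ p, derivX φ p = a) ∧ ∀ p, derivY ψ p = b := by
    intro φ ψ hφ hψ hm hYφ hXψ hZφ hZψ
    have hYa : ∀ p, derivY (derivX φ) p = 0 := fun p ↦ by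
      have := derivX_derivY hφ p
      have h1 : derivX (derivY φ) p = 0 := fderiv_eq_zero_of_const hYφ p _
      linarith [hZφ p]
    have hZa : ∀ p, derivZ (derivX φ) p = 0 := fun p ↦ by
      rw [← derivX_derivZ hφ]
      exact fderiv_eq_zero_of_const hZφ p _
    have hXb : ∀ p, derivX (derivY ψ) p = 0 := fun p ↦ by
      have := derivX_derivY hψ p
      have h1 : derivY (derivX ψ) p = 0 := fderiv_eq_zero_of_const hXψ p _
      linarith [hZψ p]
    have hXa : ∀ p, derivX (derivX φ) p = 0 := fun p ↦ by
      have h1 : derivX (fun p ↦ derivX φ p * derivY ψ p) p =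
        derivX (derivX φ) p * derivY ψ p + derivX φ p * derivX (derivY ψ) p :=
        fderiv_mul_apply hφ.derivX hψ.derivY _ _
      have h2 : derivX (fun p ↦ derivX φ p * derivY ψ p) p = 0 := fderiv_eq_zero_of_const hm p _
      rw [h2, hXb, mul_zero, add_zero] at h1
      exact (mul_eq_zero.1 h1.symm).resolve_right fun h ↦ by simpa [h] using hm p
    have ha : ∀ p, derivX φ p = derivX φ 0 := fun p ↦ eq_const_of_frame hφ.derivX hXa hYa hZa p 0
    refine ⟨derivX φ 0, derivY ψ 0, hm 0, ha, fun p ↦ ?_⟩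
    have h0 : derivX φ 0 ≠ 0 := fun h ↦ by simpa [h] using hm 0
    have h1 := hm p
    rw [ha, ← hm 0] at h1
    exact mul_left_cancel₀ h0 h1
  have hX1 : ∀ (c : ℝ) (p a : ℝ × ℝ × ℝ), fderiv ℝ (fun q : ℝ × ℝ × ℝ ↦ c * q.1) p a = c * a.1 :=
    fun c p a ↦ by rw [fderiv_const_mul (by fun_prop), fderiv_fst]; rfl
  have hY1 : ∀ (c : ℝ) (p a : ℝ × ℝ × ℝ), fderiv ℝ (fun q : ℝ × ℝ × ℝ ↦ c * q.2.1) p a = c * a.2.1 :=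
    fun c p a ↦ by
      rw [fderiv_const_mul (by fun_prop), fderiv.fst (by fun_prop), fderiv_snd]; rfl
  have hZ1 : ∀ (c : ℝ) (p a : ℝ × ℝ × ℝ), fderiv ℝ (fun q : ℝ × ℝ × ℝ ↦ c * q.2.2) p a = c * a.2.2 :=
    fun c p a ↦ by
      rw [fderiv_const_mul (by fun_prop), fderiv.snd (by fun_prop), fderiv_snd]; rfl
  -- For ε = 1 the null directions X and Y are preserved; for ε = -1 they are exchanged.
  rcases mul_self_eq_one_iff.1 hε with rfl | rfl
  · have hm : ∀ p, derivX u p * derivY v p = 1 := fun p ↦ by linarith [hsum p, hdiff p]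
    have hXv : ∀ p, derivX v p = 0 := fun p ↦
      (mul_eq_zero.1 (hXX p)).resolve_left fun h ↦ by simpa [h] using hm p
    have hYu : ∀ p, derivY u p = 0 := fun p ↦
      (mul_eq_zero.1 (hYY p)).resolve_right fun h ↦ by simpa [h] using hm p
    obtain ⟨a, b, hab, ha, hb⟩ := constant s1 s2 hm hYu hXv hZu hZv
    have ru := lin (φ := fun q ↦ a * q.1) (by fun_prop) s1 fun p c ↦ by
      rw [hX1, ha, hYu, hZu]; ring
    have rv := lin (φ := fun q ↦ b * q.2.1) (by fun_prop) s2 fun p c ↦ by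
      rw [hY1, hXv, hb, hZv]; ring
    -- Here Xw = 0, Zw = 1 and, as ab = 1, Yw = x + u(0) b. The x is produced by Yz = x.
    have rw' := lin (φ := fun q ↦ 1 * q.2.2 + (u 0 * b) * q.2.1) (by fun_prop) s3 fun p c ↦ by
      rw [fderiv_add_apply' (by fun_prop) (by fun_prop), hZ1, hY1, hXw, hYw, hXv, hb, hZw, ru p]
      simp
      linear_combination (-p.1 * c.2.1) * hab
    refine ⟨(u 0, v 0, w 0), a, b, hab, Or.inl fun p ↦ ?_⟩
    refine Prod.ext ?_ (Prod.ext ?_ ?_)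
    · rw [eu, ru]; simp; ring
    · rw [ev, rv]; simp; ring
    · rw [ew, rw']; simp; ring
  · have hm : ∀ p, derivX v p * derivY u p = 1 := fun p ↦ by linarith [hsum p, hdiff p]
    have hXu : ∀ p, derivX u p = 0 := fun p ↦
      (mul_eq_zero.1 (hXX p)).resolve_right fun h ↦ by simpa [h] using hm p
    have hYv : ∀ p, derivY v p = 0 := fun p ↦
      (mul_eq_zero.1 (hYY p)).resolve_left fun h ↦ by simpa [h] using hm p
    obtain ⟨b, a, hab, hb, ha⟩ := constant s2 s1 hm hYv hXu hZv hZu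
    have ru := lin (φ := fun q ↦ a * q.2.1) (by fun_prop) s1 fun p c ↦ by
      rw [hY1, ha, hXu, hZu]; ring
    have rv := lin (φ := fun q ↦ b * q.1) (by fun_prop) s2 fun p c ↦ by
      rw [hX1, hYv, hb, hZv]; ring
    -- Here Xw = y + u(0) b, Yw = 0, Zw = -1. The product xy supplies the y and cancels Y(-z) = -x.
    have rw' := lin (φ := fun q ↦ (-1 * q.2.2 + (u 0 * b) * q.1) + q.1 * q.2.1) (by fun_prop) s3
      fun p c ↦ by
        rw [fderiv_add_apply' (by fun_prop) (by fun_prop),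
          fderiv_add_apply' (by fun_prop) (by fun_prop), hZ1, hX1,
          fderiv_mul_apply (by fun_prop) (by fun_prop), fderiv_fst, fderiv.fst (by fun_prop),
          fderiv_snd, hXw, hYw, hYv, hb, hZw, ru p]
        simp
        linear_combination (-c.1 * p.2.1) * hab
    refine ⟨(u 0, v 0, w 0), a, b, by linarith, Or.inr fun p ↦ ?_⟩
    refine Prod.ext ?_ (Prod.ext ?_ ?_)
    · rw [eu, ru]; simp; ring
    · rw [ev, rv]; simp; ring
    · rw [ew, rw']; simp; ring

end Model

/-! ### Transport of metrics, isometry groups and actions by homotheties. -/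

section Transport

variable {E : Type*} [NormedAddCommGroup E] [NormedSpace ℝ E] {H : Type*} [TopologicalSpace H]
  {I : ModelWithCorners ℝ E H} {M : Type*} [TopologicalSpace M] [ChartedSpace H M]

/-- `f` is a homothety of ratio `c` from `B₁` to `B₂`, i.e. `f^* B₂ = c B₁`. -/
def Homothety (I : ModelWithCorners ℝ E H) {M : Type*} [TopologicalSpace M] [ChartedSpace H M]
    (B₁ B₂ : BilinField I M) (f : M → M) (c : ℝ) : Prop :=
  ∀ (x : M) (v w : TangentSpace I x),
    B₂ (f x) (mfderiv I I f x v) (mfderiv I I f x w) = c * B₁ x v w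

theorem preserves_iff_homothety {B : BilinField I M} {f : M → M} :
    Preserves I B f ↔ Homothety I B B f 1 := by
  simp only [Preserves, Homothety, one_mul]

theorem Homothety.comp {B₁ B₂ B₃ : BilinField I M} {f h : M → M} {c d : ℝ}
    (hf : Homothety I B₂ B₃ f c) (hh : Homothety I B₁ B₂ h d) (sf : ContMDiff I I ∞ f)
    (sh : ContMDiff I I ∞ h) : Homothety I B₁ B₃ (f ∘ h) (c * d) := by
  intro x v w
  have key : mfderiv I I (f ∘ h) x = (mfderiv I I f (h x)).comp (mfderiv I I h x) :=
    mfderiv_comp x ((sf (h x)).mdifferentiableAt (by simp)) ((sh x).mdifferentiableAt (by simp))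
  rw [key]
  exact (hf (h x) _ _).trans
    ((congrArg (fun r ↦ c * r) (hh x v w)).trans (mul_assoc _ _ _).symm)

theorem mfderiv_apply_mfderiv_symm {φ : M ≃ₜ M} (sf : ContMDiff I I ∞ φ)
    (sh : ContMDiff I I ∞ φ.symm) (x : M) (v : E) :
    (mfderiv I I φ (φ.symm x) (mfderiv I I φ.symm x v) : E) = v := by
  have key : mfderiv I I (φ ∘ φ.symm) x =
      (mfderiv I I φ (φ.symm x)).comp (mfderiv I I φ.symm x) :=
    mfderiv_comp _ ((sf _).mdifferentiableAt (by simp)) ((sh _).mdifferentiableAt (by simp))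
  have hid : (φ ∘ φ.symm : M → M) = id := by ext z; simp
  have := congrArg (fun L ↦ (L v : E)) key
  rw [hid] at this
  simp only [mfderiv_id] at this
  exact this.symm

/-- Tangent vectors are read in the model space E, so that a form can be moved along an equality of
base points. -/
theorem BilinField.congr_point (B : BilinField I M) {a b : M} (h : a = b) (v w : E) :
    B a (show TangentSpace I a from v) (show TangentSpace I a from w) =
      B b (show TangentSpace I b from v) (show TangentSpace I b from w) := by
  subst h; rfl

theorem Homothety.symm {B₁ B₂ : BilinField I M} {φ : M ≃ₜ M} {c : ℝ}
    (hf : Homothety I B₁ B₂ φ c) (hc : c ≠ 0) (sf : ContMDiff I I ∞ φ)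
    (sh : ContMDiff I I ∞ φ.symm) : Homothety I B₂ B₁ φ.symm c⁻¹ := by
  intro x v w
  have h2 := hf (φ.symm x) (mfderiv I I φ.symm x v) (mfderiv I I φ.symm x w)
  have h3 := B₂.congr_point (φ.apply_symm_apply x) v w
  rw [show (mfderiv I I φ (φ.symm x) (mfderiv I I φ.symm x v)) = v from
      mfderiv_apply_mfderiv_symm sf sh x v,
    show (mfderiv I I φ (φ.symm x) (mfderiv I I φ.symm x w)) = w from
      mfderiv_apply_mfderiv_symm sf sh x w] at h2
  rw [eq_inv_mul_iff_mul_eq₀ hc]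
  exact h2.symm.trans h3

section Conj

variable [IsManifold I ∞ M] {g₁ g₂ : LorentzMetric I M} {φ : M ≃ₜ M} {c : ℝ}

/-- The ratios c, 1 and c⁻¹ multiply to 1. -/
theorem conj_mem_isom (hφ : Homothety I g₁.form g₂.form φ c) (hc : c ≠ 0)
    (sf : ContMDiff I I ∞ φ) (sh : ContMDiff I I ∞ φ.symm) {ψ : M ≃ₜ M} (hψ : ψ ∈ isom g₁) :
    φ * ψ * φ⁻¹ ∈ isom g₂ := by
  obtain ⟨h1, h2, h3⟩ := hψ
  refine ⟨(sf.comp h1).comp sh, (sf.comp h2).comp sh, ?_⟩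
  have := (hφ.comp (preserves_iff_homothety.1 h3) sf h1).comp (hφ.symm hc sf sh) (sf.comp h1) sh
  rw [mul_one, mul_inv_cancel₀ hc] at this
  exact preserves_iff_homothety.2 this

theorem mem_isom_iff_conj (hφ : Homothety I g₁.form g₂.form φ c) (hc : c ≠ 0)
    (sf : ContMDiff I I ∞ φ) (sh : ContMDiff I I ∞ φ.symm) {ψ : M ≃ₜ M} :
    ψ ∈ isom g₁ ↔ φ * ψ * φ⁻¹ ∈ isom g₂ := by
  refine ⟨conj_mem_isom hφ hc sf sh, fun h ↦ ?_⟩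
  have := conj_mem_isom (φ := φ⁻¹) (hφ.symm hc sf sh) (inv_ne_zero hc) sh sf h
  simpa [mul_assoc] using this

theorem continuous_conj (φ : M ≃ₜ M) : Continuous fun ψ : M ≃ₜ M ↦ φ * ψ * φ⁻¹ := by
  refine continuous_induced_rng.2 ?_
  have h : Continuous fun ψ : M ≃ₜ M ↦ (⟨ψ, ψ.continuous⟩ : C(M, M)) := continuous_induced_dom
  have h1 : Continuous fun χ : C(M, M) ↦ χ.comp (⟨φ.symm, φ.symm.continuous⟩ : C(M, M)) :=
    ContinuousMap.continuous_precomp _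
  have h2 : Continuous fun χ : C(M, M) ↦ (⟨φ, φ.continuous⟩ : C(M, M)).comp χ :=
    ContinuousMap.continuous_postcomp _
  exact h2.comp (h1.comp h)

/-- Conjugation by `φ`, as a homeomorphism of the group of homeomorphisms. -/
def conjHomeo (φ : M ≃ₜ M) : (M ≃ₜ M) ≃ₜ (M ≃ₜ M) where
  toFun ψ := φ * ψ * φ⁻¹
  invFun ψ := φ⁻¹ * ψ * φ
  left_inv ψ := by simp [mul_assoc]
  right_inv ψ := by simp [mul_assoc]
  continuous_toFun := continuous_conj φ
  continuous_invFun := by simpa using continuous_conj φ⁻¹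

theorem conjHomeo_apply (φ ψ : M ≃ₜ M) : conjHomeo φ ψ = φ * ψ * φ⁻¹ := rfl

/-- Conjugation is a homeomorphism for the compact-open topology, fixes the identity and exchanges
the two isometry groups, so it also exchanges their identity components. -/
theorem image_conj_isomZero (hφ : Homothety I g₁.form g₂.form φ c) (hc : c ≠ 0)
    (sf : ContMDiff I I ∞ φ) (sh : ContMDiff I I ∞ φ.symm) :
    conjHomeo φ '' isomZero g₁ = isomZero g₂ := by
  have himage : conjHomeo φ '' (isom g₁ : Set (M ≃ₜ M)) = isom g₂ := by
    ext ψ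
    constructor
    · rintro ⟨χ, hχ, rfl⟩
      exact conj_mem_isom hφ hc sf sh hχ
    · intro h
      refine ⟨φ⁻¹ * ψ * φ, (mem_isom_iff_conj hφ hc sf sh).2 ?_, ?_⟩
      · simpa [mul_assoc] using h
      · simp [conjHomeo_apply, mul_assoc]
  rw [isomZero, isomZero, (conjHomeo φ).image_connectedComponentIn (isom g₁).one_mem, himage]
  simp [conjHomeo_apply]

theorem sameGeometry_of_homothety (hφ : Homothety I g₁.form g₂.form φ c) (hc : c ≠ 0)
    (sf : ContMDiff I I ∞ φ) (sh : ContMDiff I I ∞ φ.symm) : SameGeometry g₁ g₂ := by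
  refine ⟨φ, sf, sh, fun ψ ↦ ?_⟩
  rw [← image_conj_isomZero hφ hc sf sh, ← conjHomeo_apply,
    (conjHomeo φ).injective.mem_set_image]

end Conj

section Actions

variable {G : Type*} [Group G]

/-- The action `ρ` conjugated by `φ`. -/
def conjAction (φ : M ≃ₜ M) (ρ : G →* (M ≃ₜ M)) : G →* (M ≃ₜ M) :=
  (MulAut.conj φ).toMonoidHom.comp ρ

theorem conjAction_injective {ρ : G →* (M ≃ₜ M)} (h : Function.Injective ρ) (φ : M ≃ₜ M) :
    Function.Injective (conjAction φ ρ) :=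
  (MulAut.conj φ).injective.comp h

section Smooth

variable {F : Type*} [NormedAddCommGroup F] [NormedSpace ℝ F] {K : Type*} [TopologicalSpace K]
  [TopologicalSpace G] [ChartedSpace K G] {J : ModelWithCorners ℝ F K}

theorem SmoothAction.contMDiff {ρ : G →* (M ≃ₜ M)} (h : SmoothAction J I ρ) (a : G) :
    ContMDiff I I ∞ (ρ a) := by
  have h1 : ContMDiff I (J.prod I) ∞ fun x : M ↦ (a, x) := contMDiff_const.prodMk contMDiff_id
  exact ContMDiff.comp (g := fun q : G × M ↦ ρ q.1 q.2) h h1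

theorem SmoothAction.contMDiff_orbit {ρ : G →* (M ≃ₜ M)} (h : SmoothAction J I ρ) (p : M) :
    ContMDiff J I ∞ (fun a ↦ ρ a p) :=
  ContMDiff.comp h (contMDiff_id.prodMk contMDiff_const : ContMDiff J (J.prod I) ∞ fun a ↦ (a, p))

theorem SmoothAction.contMDiff_symm {ρ : G →* (M ≃ₜ M)} (h : SmoothAction J I ρ) (a : G) :
    ContMDiff I I ∞ (ρ a).symm := by
  have := h.contMDiff a⁻¹
  rw [map_inv] at this
  exact this

theorem SmoothAction.conj {ρ : G →* (M ≃ₜ M)} (h : SmoothAction J I ρ) {φ : M ≃ₜ M}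
    (sf : ContMDiff I I ∞ φ) (sh : ContMDiff I I ∞ φ.symm) :
    SmoothAction J I (conjAction φ ρ) := by
  have h1 : ContMDiff (J.prod I) (J.prod I) ∞ fun q : G × M ↦ (q.1, φ.symm q.2) :=
    contMDiff_fst.prodMk (sh.comp contMDiff_snd)
  exact sf.comp (ContMDiff.comp h h1)

end Smooth

/-- Semisimplicity of the isotropy is invariant under a diffeomorphism which intertwines the
actions. -/
theorem SemisimpleIsotropy.transport [IsManifold I ∞ M] {ρ ρ' : G →* (M ≃ₜ M)} {p : M}
    (h : SemisimpleIsotropy I ρ p) (hρ : ∀ a, ContMDiff I I ∞ (ρ a))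
    (hρ' : ∀ a, ContMDiff I I ∞ (ρ' a)) {φ : M ≃ₜ M}
    (sf : ContMDiff I I ∞ φ) (sh : ContMDiff I I ∞ φ.symm) {e : G → G}
    (he : Function.Surjective e) (hφ : ∀ a x, ρ' (e a) (φ x) = φ (ρ a x)) :
    SemisimpleIsotropy I ρ' (φ p) := by
  obtain ⟨b, c, hc, h1, h2⟩ := h
  let Φ : M ≃ₘ^∞⟮I, I⟯ M := ⟨φ.toEquiv, sf, sh⟩
  -- The differential of φ at p conjugates the isotropy at p to that at φ p, so the image basis has
  -- the same exponents.
  let L : E ≃L[ℝ] E := Φ.mfderivToContinuousLinearEquiv (by simp) p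
  have hL : ∀ v : E, L v = mfderiv I I φ p v := fun v ↦ rfl
  have hfix : ∀ a, ρ' (e a) (φ p) = φ p ↔ ρ a p = p := fun a ↦ by
    rw [hφ, φ.injective.eq_iff]
  have key : ∀ a, ρ a p = p → ∀ v : E,
      (mfderiv I I (ρ' (e a)) (φ p) (L v) : E) = L (mfderiv I I (ρ a) p v : E) := by
    intro a ha v
    have e1 := mfderiv_comp p (((hρ' (e a)) (φ p)).mdifferentiableAt (by simp))
      ((sf p).mdifferentiableAt (by simp))
    have e2 := mfderiv_comp p ((sf (ρ a p)).mdifferentiableAt (by simp))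
      (((hρ a) p).mdifferentiableAt (by simp))
    rw [show (ρ' (e a)) ∘ φ = φ ∘ (ρ a) from funext (hφ a), e2] at e1
    have e3 := congrArg (fun T ↦ (T v : E)) e1
    have e4 : ∀ (q : M) (_ : q = p) (u : E), (mfderiv I I φ q u : E) = mfderiv I I φ p u := by
      rintro _ rfl u; rfl
    refine e3.symm.trans ?_
    exact e4 _ ha _
  refine ⟨b.map L.toLinearEquiv, c, hc, fun t ↦ ?_, fun a ha ↦ ?_⟩
  · obtain ⟨a, ha, hb⟩ := h1 t
    refine ⟨e a, (hfix a).2 ha, fun i ↦ ?_⟩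
    refine (key a ha (b i)).trans ?_
    rw [hb i, map_smul]
    rfl
  · obtain ⟨a, rfl⟩ := he a
    have ha' := (hfix a).1 ha
    obtain ⟨t, ht⟩ := h2 a ha'
    refine ⟨t, fun i ↦ (key a ha' (b i)).trans ?_⟩
    rw [ht i, map_smul]
    rfl

/-- A group with non-trivial semisimple isotropy preserves no Riemannian metric. -/
theorem SemisimpleIsotropy.nonRiemannian [IsManifold I ∞ M] {ρ : G →* (M ≃ₜ M)} {p : M}
    (h : SemisimpleIsotropy I ρ p) : NonRiemannian I ρ := by
  rintro ⟨m, hm⟩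
  obtain ⟨b, c, hc, h1, -⟩ := h
  obtain ⟨i, hi⟩ := Function.ne_iff.1 hc
  obtain ⟨a, ha, hb⟩ := h1 1
  have h2 := hm a p (b i) (b i)
  have h3 := BilinField.congr_point (I := I) m.inner ha (mfderiv I I (ρ a) p (b i) : E)
    (mfderiv I I (ρ a) p (b i) : E)
  have h4 := h3.symm.trans h2
  rw [hb i, one_mul] at h4
  have h5 := m.pos p (b i) (b.ne_zero i)
  have h6 : Real.exp (c i) * (Real.exp (c i) * m.inner p (b i) (b i)) = m.inner p (b i) (b i) := by
    refine Eq.trans ?_ h4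
    have : ∀ (r : ℝ) (v w : TangentSpace I p), r * (r * m.inner p v w) =
      m.inner p (r • v) (r • w) := by
      intro r v w
      simp
    exact this _ _ _
  -- An eigenvector of an orthogonal map has eigenvalue of square 1, whereas c i ≠ 0.
  have h7 : Real.exp (c i) * Real.exp (c i) = 1 := by
    refine mul_right_cancel₀ h5.ne' ?_
    rw [one_mul, mul_assoc, h6]
  rw [← Real.exp_add, Real.exp_eq_one_iff] at h7
  apply hi
  simp only [Pi.zero_apply]
  linarith

end Actions

end Transport

/-! ### The Lie algebra of the Heisenberg group and the model metric. -/

section HeisMetric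

theorem Heis.mfderiv_eq (f : Heis → Heis) (x : Heis) :
    mfderiv 𝓘(ℝ, ℝ × ℝ × ℝ) 𝓘(ℝ, ℝ × ℝ × ℝ) f x =
      fderiv ℝ (E := ℝ × ℝ × ℝ) (F := ℝ × ℝ × ℝ) f x :=
  mfderiv_eq_fderiv

theorem Heis.contMDiff_iff (f : Heis → Heis) :
    ContMDiff 𝓘(ℝ, ℝ × ℝ × ℝ) 𝓘(ℝ, ℝ × ℝ × ℝ) ∞ f ↔
      ContDiff ℝ ∞ (E := ℝ × ℝ × ℝ) (F := ℝ × ℝ × ℝ) f :=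
  contMDiff_iff_contDiff

theorem Heis.hasFDerivAt_mul_left (a x : Heis) :
    HasFDerivAt (E := ℝ × ℝ × ℝ) (F := ℝ × ℝ × ℝ) (fun y : Heis ↦ a * y)
      ((ContinuousLinearMap.fst ℝ ℝ (ℝ × ℝ)).prod
        (((ContinuousLinearMap.fst ℝ ℝ ℝ).comp (ContinuousLinearMap.snd ℝ ℝ (ℝ × ℝ))).prod
        ((ContinuousLinearMap.snd ℝ ℝ ℝ).comp (ContinuousLinearMap.snd ℝ ℝ (ℝ × ℝ)) +
          a.1 • (ContinuousLinearMap.fst ℝ ℝ ℝ).comp (ContinuousLinearMap.snd ℝ ℝ (ℝ × ℝ))))) x := by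
  have h1 : HasFDerivAt (fun y : ℝ × ℝ × ℝ ↦ y.2.1)
    ((ContinuousLinearMap.fst ℝ ℝ ℝ).comp (ContinuousLinearMap.snd ℝ ℝ (ℝ × ℝ))) x :=
    ((ContinuousLinearMap.fst ℝ ℝ ℝ).comp (ContinuousLinearMap.snd ℝ ℝ (ℝ × ℝ))).hasFDerivAt
  have h2 : HasFDerivAt (fun y : ℝ × ℝ × ℝ ↦ y.2.2)
    ((ContinuousLinearMap.snd ℝ ℝ ℝ).comp (ContinuousLinearMap.snd ℝ ℝ (ℝ × ℝ))) x :=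
    ((ContinuousLinearMap.snd ℝ ℝ ℝ).comp (ContinuousLinearMap.snd ℝ ℝ (ℝ × ℝ))).hasFDerivAt
  exact (hasFDerivAt_fst.const_add a.1).prodMk
    ((h1.const_add a.2.1).prodMk ((h2.const_add a.2.2).add (h1.const_mul a.1)))

theorem Heis.mfderiv_mul_left (a x : Heis) (v : ℝ × ℝ × ℝ) :
    (mfderiv 𝓘(ℝ, ℝ × ℝ × ℝ) 𝓘(ℝ, ℝ × ℝ × ℝ) (fun y ↦ a * y) x v : ℝ × ℝ × ℝ) =
      (v.1, v.2.1, v.2.2 + a.1 * v.2.1) := by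
  rw [Heis.mfderiv_eq, (Heis.hasFDerivAt_mul_left a x).fderiv]
  rfl

/-- The left-invariant vector field on `ℝ³` with value `u` at the origin. -/
def leftField (u p : ℝ × ℝ × ℝ) : ℝ × ℝ × ℝ := (u.1, u.2.1, u.2.2 + p.1 * u.2.1)

theorem fderiv_leftField (u p a : ℝ × ℝ × ℝ) :
    fderiv ℝ (leftField u) p a = (0, 0, a.1 * u.2.1) := by
  have h : HasFDerivAt (leftField u) ((0 : ℝ × ℝ × ℝ →L[ℝ] ℝ).prod ((0 : ℝ × ℝ × ℝ →L[ℝ] ℝ).prod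
      (u.2.1 • ContinuousLinearMap.fst ℝ ℝ (ℝ × ℝ)))) p :=
    (hasFDerivAt_const _ _).prodMk ((hasFDerivAt_const _ _).prodMk
      ((hasFDerivAt_fst.mul_const _).const_add _))
  rw [h.fderiv]
  simp [mul_comm]

theorem lieBracket_leftField (v w : ℝ × ℝ × ℝ) :
    VectorField.lieBracket ℝ (leftField v) (leftField w) 0 =
      (0, 0, v.1 * w.2.1 - v.2.1 * w.1) := by
  rw [VectorField.lieBracket, fderiv_leftField, fderiv_leftField]
  simp [leftField, mul_comm]

/-- The Lie bracket of the Lie algebra of the Heisenberg group. -/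
theorem Heis.bracket_eq (v w : GroupLieAlgebra 𝓘(ℝ, ℝ × ℝ × ℝ) Heis) :
    (⁅v, w⁆ : GroupLieAlgebra 𝓘(ℝ, ℝ × ℝ × ℝ) Heis) =
      ((0, 0, v.1 * w.2.1 - v.2.1 * w.1) : ℝ × ℝ × ℝ) := by
  have hfield : ∀ u : GroupLieAlgebra 𝓘(ℝ, ℝ × ℝ × ℝ) Heis,
      (mulInvariantVectorField u : Heis → ℝ × ℝ × ℝ) = leftField u :=
    fun u ↦ funext fun p ↦ Heis.mfderiv_mul_left p 1 u
  have h := congrFun (VectorField.mlieBracketWithin_eq_lieBracketWithin (𝕜 := ℝ)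
    (V := leftField v) (W := leftField w) (s := Set.univ)) (0 : ℝ × ℝ × ℝ)
  rw [VectorField.lieBracketWithin_univ] at h
  rw [GroupLieAlgebra.bracket_def]
  exact ((congrArg₂ (fun V W ↦ VectorField.mlieBracket 𝓘(ℝ, ℝ × ℝ × ℝ) V W (1 : Heis))
    (hfield v) (hfield w)).trans h).trans (lieBracket_leftField v w)

/-- The brackets with (1, 0, 0) and (0, 1, 0) read off the two coordinates that must vanish. -/
theorem Heis.mem_center_iff (v : GroupLieAlgebra 𝓘(ℝ, ℝ × ℝ × ℝ) Heis) :
    v ∈ LieAlgebra.center ℝ (GroupLieAlgebra 𝓘(ℝ, ℝ × ℝ × ℝ) Heis) ↔ v.1 = 0 ∧ v.2.1 = 0 := by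
  rw [LieAlgebra.center, LieModule.mem_maxTrivSubmodule]
  constructor
  · intro h
    have h1 := (Heis.bracket_eq ((1, 0, 0) : ℝ × ℝ × ℝ) v).symm.trans (h _)
    have h2 := (Heis.bracket_eq ((0, 1, 0) : ℝ × ℝ × ℝ) v).symm.trans (h _)
    have h3 : (1 : ℝ) * v.2.1 - 0 * v.1 = 0 := congrArg (fun u : ℝ × ℝ × ℝ ↦ u.2.2) h1
    have h4 : (0 : ℝ) * v.2.1 - 1 * v.1 = 0 := congrArg (fun u : ℝ × ℝ × ℝ ↦ u.2.2) h2
    exact ⟨by linarith, by linarith⟩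
  · rintro ⟨h1, h2⟩ w
    rw [Heis.bracket_eq, h1, h2, mul_zero, mul_zero, sub_zero]
    rfl

/-- The model metric `2 dx dy + (dz - x dy)²` as a field of continuous bilinear forms. -/
noncomputable def modelBilin (p : ℝ × ℝ × ℝ) : ℝ × ℝ × ℝ →L[ℝ] ℝ × ℝ × ℝ →L[ℝ] ℝ :=
  let α := ContinuousLinearMap.fst ℝ ℝ (ℝ × ℝ)
  let β := (ContinuousLinearMap.fst ℝ ℝ ℝ).comp (ContinuousLinearMap.snd ℝ ℝ (ℝ × ℝ))
  let θ := (ContinuousLinearMap.snd ℝ ℝ ℝ).comp (ContinuousLinearMap.snd ℝ ℝ (ℝ × ℝ)) - p.1 • β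
  α.smulRight β + β.smulRight α + θ.smulRight θ

theorem modelBilin_apply (p v w : ℝ × ℝ × ℝ) : modelBilin p v w = modelForm p v w := by
  simp [modelBilin, modelForm]

theorem contDiff_modelBilin : ContDiff ℝ ∞ modelBilin := by
  unfold modelBilin
  have h : ContDiff ℝ ∞ fun p : ℝ × ℝ × ℝ ↦
      (ContinuousLinearMap.snd ℝ ℝ ℝ).comp (ContinuousLinearMap.snd ℝ ℝ (ℝ × ℝ)) - p.1 •
        (ContinuousLinearMap.fst ℝ ℝ ℝ).comp (ContinuousLinearMap.snd ℝ ℝ (ℝ × ℝ)) :=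
    contDiff_const.sub (contDiff_fst.smul contDiff_const)
  exact contDiff_const.add (h.smulRight h)

/-- A smooth field of bilinear forms on a vector space is a smooth section of the bundle of bilinear
forms on the tangent spaces. -/
theorem contMDiff_bilinField {F : Type*} [NormedAddCommGroup F] [NormedSpace ℝ F]
    {B : F → F →L[ℝ] F →L[ℝ] ℝ} (hB : ContDiff ℝ ∞ B) :
    ContMDiff 𝓘(ℝ, F) (𝓘(ℝ, F).prod 𝓘(ℝ, F →L[ℝ] F →L[ℝ] ℝ)) ∞
      (fun x ↦ Bundle.TotalSpace.mk' (F →L[ℝ] F →L[ℝ] ℝ)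
        (E := fun x : F ↦ TangentSpace 𝓘(ℝ, F) x →L[ℝ] TangentSpace 𝓘(ℝ, F) x →L[ℝ] ℝ) x (B x)) := by
  intro x
  refine (Bundle.contMDiffAt_section
    (E := fun x : F ↦ TangentSpace 𝓘(ℝ, F) x →L[ℝ] TangentSpace 𝓘(ℝ, F) x →L[ℝ] ℝ) x).2 ?_
  refine hB.contMDiff.contMDiffAt.congr_of_eventuallyEq (Filter.Eventually.of_forall fun p ↦ ?_)
  refine ContinuousLinearMap.ext fun v ↦ ContinuousLinearMap.ext fun w ↦ ?_
  -- On a vector space the tangent trivializations are the identity, so the section read in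
  -- coordinates is B itself.
  simp only [hom_trivializationAt_apply, ContinuousLinearMap.inCoordinates,
    TangentBundle.symmL_model_space, ContinuousLinearMap.coe_comp, Function.comp_apply,
    Bundle.Trivialization.continuousLinearMapAt_apply]
  rw [Bundle.Trivialization.linearMapAt_apply, if_pos]
  · rw [hom_trivializationAt_apply]
    simp [ContinuousLinearMap.inCoordinates]
    rfl
  · simp [hom_trivializationAt_baseSet, chartAt_self_eq]

/-- The model Lorentz metric `2 dx dy + (dz - x dy)²` on the Heisenberg group. -/
noncomputable def modelMetric : LorentzMetric 𝓘(ℝ, ℝ × ℝ × ℝ) Heis where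
  form p := modelBilin p
  symm p v w := by
    refine (modelBilin_apply _ _ _).trans (Eq.trans ?_ (modelBilin_apply _ _ _).symm)
    unfold modelForm
    ring
  signature p := by
    -- The timelike vector is X - Y at p, of square -2. Vectors orthogonal to it have equal first
    -- two coordinates.
    refine ⟨((1, -1, -p.1) : ℝ × ℝ × ℝ), ?_, fun w h hw ↦ ?_⟩
    · refine (modelBilin_apply _ _ _).trans_lt ?_
      norm_num [modelForm]
    · have h1 := (modelBilin_apply _ _ _).symm.trans h
      refine lt_of_lt_of_eq ?_ (modelBilin_apply _ _ _).symm
      simp only [modelForm] at h1 ⊢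
      have h2 : w.1 = w.2.1 := by linarith
      rw [h2]
      by_contra h3
      have h4 : w.2.1 = 0 := by nlinarith [sq_nonneg (w.2.2 - p.1 * w.2.1), sq_nonneg w.2.1]
      rw [h4] at h3
      have h5 : w.2.2 = 0 := by nlinarith [sq_nonneg w.2.2]
      exact hw (Prod.ext (h2.trans h4) (Prod.ext h4 h5))
  contMDiff := contMDiff_bilinField contDiff_modelBilin

theorem modelMetric_form (p : Heis) (v w : ℝ × ℝ × ℝ) :
    modelMetric.form p v w = modelForm p v w := modelBilin_apply p v w

end HeisMetric

/-! ### Normal form of the left-invariant metrics positive on the center. -/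

section NormalForm

/-- The reduction of a tangent vector at `p` to a vector at the origin, by left translation. -/
def toOrigin (p v : ℝ × ℝ × ℝ) : ℝ × ℝ × ℝ := (v.1, v.2.1, v.2.2 - p.1 * v.2.1)

theorem modelForm_eq_toOrigin (p v w : ℝ × ℝ × ℝ) :
    modelForm p v w = modelForm 0 (toOrigin p v) (toOrigin p w) := by
  simp [modelForm, toOrigin]

/-- Left translation by p carries the value at the identity to p; comparing two left-invariant
metrics thus becomes linear algebra on the Lie algebra. -/
theorem LeftInvariant.form_eq {g : LorentzMetric 𝓘(ℝ, ℝ × ℝ × ℝ) Heis} (hg : LeftInvariant g)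
    (p : Heis) (v w : ℝ × ℝ × ℝ) :
    g.form p v w = g.form 1 (toOrigin p v) (toOrigin p w) := by
  have h := hg p 1 (toOrigin p v) (toOrigin p w)
  have h2 := BilinField.congr_point g.form (mul_one p)
    (mfderiv 𝓘(ℝ, ℝ × ℝ × ℝ) 𝓘(ℝ, ℝ × ℝ × ℝ) (fun y ↦ p * y) 1 (toOrigin p v) : ℝ × ℝ × ℝ)
    (mfderiv 𝓘(ℝ, ℝ × ℝ × ℝ) 𝓘(ℝ, ℝ × ℝ × ℝ) (fun y ↦ p * y) 1 (toOrigin p w) : ℝ × ℝ × ℝ)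
  have h3 := h2.symm.trans h
  rw [Heis.mfderiv_mul_left, Heis.mfderiv_mul_left] at h3
  refine Eq.trans ?_ h3
  simp only [toOrigin, sub_add_cancel]

theorem leftInvariant_iff {g : LorentzMetric 𝓘(ℝ, ℝ × ℝ × ℝ) Heis} :
    LeftInvariant g ↔ ∀ (p : Heis) (v w : ℝ × ℝ × ℝ),
      g.form p v w = g.form 1 (toOrigin p v) (toOrigin p w) := by
  refine ⟨fun h ↦ h.form_eq, fun h a x v w ↦ ?_⟩
  refine (h _ _ _).trans (Eq.trans ?_ (h _ _ _).symm)
  have e : ∀ u : ℝ × ℝ × ℝ, toOrigin (a * x : Heis)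
      (mfderiv 𝓘(ℝ, ℝ × ℝ × ℝ) 𝓘(ℝ, ℝ × ℝ × ℝ) (fun y ↦ a * y) x u : ℝ × ℝ × ℝ) = toOrigin x u := by
    intro u
    rw [Heis.mfderiv_mul_left]
    refine Prod.ext rfl (Prod.ext rfl ?_)
    change u.2.2 + a.1 * u.2.1 - (a.1 + x.1) * u.2.1 = u.2.2 - x.1 * u.2.1
    ring
  exact congrArg₂ (fun v w : ℝ × ℝ × ℝ ↦ g.form 1 v w) (e v) (e w)

theorem leftInvariant_modelMetric : LeftInvariant modelMetric :=
  leftInvariant_iff.2 fun p v w ↦ by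
    refine (modelMetric_form p v w).trans (Eq.trans ?_ (modelMetric_form 1 _ _).symm)
    exact modelForm_eq_toOrigin p v w

theorem centerPositive_modelMetric : CenterPositive modelMetric := by
  intro v hv hv0
  obtain ⟨h1, h2⟩ := (Heis.mem_center_iff v).1 hv
  refine lt_of_lt_of_eq ?_ (modelMetric_form 1 v v).symm
  have h3 : v.2.2 ≠ 0 := fun h ↦ hv0 (Prod.ext h1 (Prod.ext h2 h))
  unfold modelForm
  rw [h1, h2]
  have := mul_self_pos.2 h3
  simpa using this

/-- The automorphism of the Heisenberg group whose differential at the origin maps the first two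
basis vectors to `a` and `b`. -/
noncomputable def heisAut (a b : ℝ × ℝ × ℝ) (h : a.1 * b.2.1 - a.2.1 * b.1 ≠ 0) : Heis ≃* Heis where
  -- In exponential coordinates, z = ζ + xy/2, the automorphism is linear with ζ multiplied by the
  -- determinant. Returning to z produces the quadratic terms.
  toFun p := (p.1 * a.1 + p.2.1 * b.1, p.1 * a.2.1 + p.2.1 * b.2.1,
    p.1 * a.2.2 + p.2.1 * b.2.2 + p.1 * p.1 * (a.1 * a.2.1 / 2) + p.2.1 * p.2.1 * (b.1 * b.2.1 / 2) +
      p.1 * p.2.1 * (b.1 * a.2.1) + (a.1 * b.2.1 - a.2.1 * b.1) * p.2.2)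
  invFun q :=
    let l := (a.1 * b.2.1 - a.2.1 * b.1)⁻¹
    let x := l * (b.2.1 * q.1 - b.1 * q.2.1)
    let y := l * (a.1 * q.2.1 - a.2.1 * q.1)
    (x, y, l * (q.2.2 - (x * a.2.2 + y * b.2.2 + x * x * (a.1 * a.2.1 / 2) +
      y * y * (b.1 * b.2.1 / 2) + x * y * (b.1 * a.2.1))))
  left_inv p := by
    have h1 : (a.1 * b.2.1 - a.2.1 * b.1)⁻¹ * (b.2.1 * (p.1 * a.1 + p.2.1 * b.1) -
        b.1 * (p.1 * a.2.1 + p.2.1 * b.2.1)) = p.1 := by field_simp; ring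
    have h2 : (a.1 * b.2.1 - a.2.1 * b.1)⁻¹ * (a.1 * (p.1 * a.2.1 + p.2.1 * b.2.1) -
        a.2.1 * (p.1 * a.1 + p.2.1 * b.1)) = p.2.1 := by field_simp; ring
    refine Prod.ext h1 (Prod.ext h2 ?_)
    dsimp only
    rw [h1, h2]
    field_simp
    ring
  right_inv q := by
    refine Prod.ext ?_ (Prod.ext ?_ ?_)
    · dsimp only; field_simp; ring
    · dsimp only; field_simp; ring
    · dsimp only; rw [mul_inv_cancel_left₀ h]; ring
  map_mul' p q := by
    refine Prod.ext ?_ (Prod.ext ?_ ?_)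
    · change (p.1 + q.1) * a.1 + (p.2.1 + q.2.1) * b.1 =
        (p.1 * a.1 + p.2.1 * b.1) + (q.1 * a.1 + q.2.1 * b.1)
      ring
    · change (p.1 + q.1) * a.2.1 + (p.2.1 + q.2.1) * b.2.1 =
        (p.1 * a.2.1 + p.2.1 * b.2.1) + (q.1 * a.2.1 + q.2.1 * b.2.1)
      ring
    · change (p.1 + q.1) * a.2.2 + (p.2.1 + q.2.1) * b.2.2 +
          (p.1 + q.1) * (p.1 + q.1) * (a.1 * a.2.1 / 2) +
          (p.2.1 + q.2.1) * (p.2.1 + q.2.1) * (b.1 * b.2.1 / 2) +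
          (p.1 + q.1) * (p.2.1 + q.2.1) * (b.1 * a.2.1) +
          (a.1 * b.2.1 - a.2.1 * b.1) * (p.2.2 + q.2.2 + p.1 * q.2.1) =
        (p.1 * a.2.2 + p.2.1 * b.2.2 + p.1 * p.1 * (a.1 * a.2.1 / 2) +
          p.2.1 * p.2.1 * (b.1 * b.2.1 / 2) + p.1 * p.2.1 * (b.1 * a.2.1) +
          (a.1 * b.2.1 - a.2.1 * b.1) * p.2.2) +
        (q.1 * a.2.2 + q.2.1 * b.2.2 + q.1 * q.1 * (a.1 * a.2.1 / 2) +
          q.2.1 * q.2.1 * (b.1 * b.2.1 / 2) + q.1 * q.2.1 * (b.1 * a.2.1) +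
          (a.1 * b.2.1 - a.2.1 * b.1) * q.2.2) +
        (p.1 * a.1 + p.2.1 * b.1) * (q.1 * a.2.1 + q.2.1 * b.2.1)
      ring

theorem contMDiff_heisAut (a b : ℝ × ℝ × ℝ) (h : a.1 * b.2.1 - a.2.1 * b.1 ≠ 0) :
    ContMDiff 𝓘(ℝ, ℝ × ℝ × ℝ) 𝓘(ℝ, ℝ × ℝ × ℝ) ∞ (heisAut a b h) := by
  have : ContDiff ℝ ∞ fun p : ℝ × ℝ × ℝ ↦
      ((p.1 * a.1 + p.2.1 * b.1, p.1 * a.2.1 + p.2.1 * b.2.1,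
    p.1 * a.2.2 + p.2.1 * b.2.2 + p.1 * p.1 * (a.1 * a.2.1 / 2) + p.2.1 * p.2.1 * (b.1 * b.2.1 / 2) +
      p.1 * p.2.1 * (b.1 * a.2.1) + (a.1 * b.2.1 - a.2.1 * b.1) * p.2.2) : ℝ × ℝ × ℝ) := by
    fun_prop
  exact this.contMDiff

theorem contMDiff_heisAut_symm (a b : ℝ × ℝ × ℝ) (h : a.1 * b.2.1 - a.2.1 * b.1 ≠ 0) :
    ContMDiff 𝓘(ℝ, ℝ × ℝ × ℝ) 𝓘(ℝ, ℝ × ℝ × ℝ) ∞ (heisAut a b h).symm := by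
  generalize hl : (a.1 * b.2.1 - a.2.1 * b.1)⁻¹ = l
  have : ContDiff ℝ ∞ fun q : ℝ × ℝ × ℝ ↦
      ((l * (b.2.1 * q.1 - b.1 * q.2.1), l * (a.1 * q.2.1 - a.2.1 * q.1),
        l * (q.2.2 - (l * (b.2.1 * q.1 - b.1 * q.2.1) * a.2.2 +
          l * (a.1 * q.2.1 - a.2.1 * q.1) * b.2.2 +
          l * (b.2.1 * q.1 - b.1 * q.2.1) * (l * (b.2.1 * q.1 - b.1 * q.2.1)) *
            (a.1 * a.2.1 / 2) +
          l * (a.1 * q.2.1 - a.2.1 * q.1) * (l * (a.1 * q.2.1 - a.2.1 * q.1)) *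
            (b.1 * b.2.1 / 2) +
          l * (b.2.1 * q.1 - b.1 * q.2.1) * (l * (a.1 * q.2.1 - a.2.1 * q.1)) *
            (b.1 * a.2.1)))) : ℝ × ℝ × ℝ) := by
    fun_prop
  subst hl
  exact this.contMDiff

theorem mfderiv_heisAut (a b : ℝ × ℝ × ℝ) (h : a.1 * b.2.1 - a.2.1 * b.1 ≠ 0) (p : Heis)
    (v : ℝ × ℝ × ℝ) :
    (mfderiv 𝓘(ℝ, ℝ × ℝ × ℝ) 𝓘(ℝ, ℝ × ℝ × ℝ) (heisAut a b h) p v : ℝ × ℝ × ℝ) =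
      (v.1 * a.1 + v.2.1 * b.1, v.1 * a.2.1 + v.2.1 * b.2.1,
        v.1 * a.2.2 + v.2.1 * b.2.2 + (v.1 * p.1 + p.1 * v.1) * (a.1 * a.2.1 / 2) +
          (v.2.1 * p.2.1 + p.2.1 * v.2.1) * (b.1 * b.2.1 / 2) +
          (v.1 * p.2.1 + p.1 * v.2.1) * (b.1 * a.2.1) +
          (a.1 * b.2.1 - a.2.1 * b.1) * v.2.2) := by
  rw [Heis.mfderiv_eq]
  have hx : HasFDerivAt (fun y : ℝ × ℝ × ℝ ↦ y.1) (ContinuousLinearMap.fst ℝ ℝ (ℝ × ℝ)) p :=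
    (ContinuousLinearMap.fst ℝ ℝ (ℝ × ℝ)).hasFDerivAt
  have hy : HasFDerivAt (fun y : ℝ × ℝ × ℝ ↦ y.2.1)
    ((ContinuousLinearMap.fst ℝ ℝ ℝ).comp (ContinuousLinearMap.snd ℝ ℝ (ℝ × ℝ))) p :=
    ((ContinuousLinearMap.fst ℝ ℝ ℝ).comp (ContinuousLinearMap.snd ℝ ℝ (ℝ × ℝ))).hasFDerivAt
  have hz : HasFDerivAt (fun y : ℝ × ℝ × ℝ ↦ y.2.2)
    ((ContinuousLinearMap.snd ℝ ℝ ℝ).comp (ContinuousLinearMap.snd ℝ ℝ (ℝ × ℝ))) p :=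
    ((ContinuousLinearMap.snd ℝ ℝ ℝ).comp (ContinuousLinearMap.snd ℝ ℝ (ℝ × ℝ))).hasFDerivAt
  have key := ((hx.mul_const a.1).add (hy.mul_const b.1)).prodMk
    (((hx.mul_const a.2.1).add (hy.mul_const b.2.1)).prodMk
    ((((((hx.mul_const a.2.2).add (hy.mul_const b.2.2)).add
      ((hx.mul hx).mul_const (a.1 * a.2.1 / 2))).add
      ((hy.mul hy).mul_const (b.1 * b.2.1 / 2))).add
      ((hx.mul hy).mul_const (b.1 * a.2.1))).add
      (hz.const_mul (a.1 * b.2.1 - a.2.1 * b.1))))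
  have h2 := congrArg (fun L : ℝ × ℝ × ℝ →L[ℝ] ℝ × ℝ × ℝ ↦ L v) key.fderiv
  refine Eq.trans h2 ?_
  refine Prod.ext ?_ (Prod.ext ?_ ?_) <;> simp <;> ring

/-- The automorphism `heisAut`, as a homeomorphism. -/
noncomputable def heisAutHomeo (a b : ℝ × ℝ × ℝ) (h : a.1 * b.2.1 - a.2.1 * b.1 ≠ 0) :
    Heis ≃ₜ Heis where
  toEquiv := (heisAut a b h).toEquiv
  continuous_toFun := (contMDiff_heisAut a b h).continuous
  continuous_invFun := (contMDiff_heisAut_symm a b h).continuous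

/-- A left-invariant metric in normal form in a basis `(a, b, λ ∂_z)` is homothetic to the model
metric. -/
theorem homothety_heisAut {g : LorentzMetric 𝓘(ℝ, ℝ × ℝ × ℝ) Heis} (hg : LeftInvariant g)
    {a b : ℝ × ℝ × ℝ} {c : ℝ} (h : a.1 * b.2.1 - a.2.1 * b.1 ≠ 0)
    (hab : ∀ v w : ℝ × ℝ × ℝ,
      g.form 1 (v.1 • a + v.2.1 • b + ((a.1 * b.2.1 - a.2.1 * b.1) * v.2.2) • ((0, 0, 1) : ℝ × ℝ × ℝ))
        (w.1 • a + w.2.1 • b + ((a.1 * b.2.1 - a.2.1 * b.1) * w.2.2) • ((0, 0, 1) : ℝ × ℝ × ℝ)) =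
      c * modelForm 0 v w) :
    Homothety 𝓘(ℝ, ℝ × ℝ × ℝ) modelMetric.form g.form (heisAut a b h) c := by
  intro p v w
  have e : ∀ u : ℝ × ℝ × ℝ, toOrigin (heisAut a b h p)
      (mfderiv 𝓘(ℝ, ℝ × ℝ × ℝ) 𝓘(ℝ, ℝ × ℝ × ℝ) (heisAut a b h) p u : ℝ × ℝ × ℝ) =
      (toOrigin p u).1 • a + (toOrigin p u).2.1 • b +
        ((a.1 * b.2.1 - a.2.1 * b.1) * (toOrigin p u).2.2) • ((0, 0, 1) : ℝ × ℝ × ℝ) := by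
    intro u
    rw [mfderiv_heisAut]
    have e1 : (heisAut a b h p).1 = p.1 * a.1 + p.2.1 * b.1 := rfl
    refine Prod.ext ?_ (Prod.ext ?_ ?_)
    · simp [toOrigin]
    · simp [toOrigin]
    · simp [toOrigin, e1]
      ring
  refine (hg.form_eq _ _ _).trans ?_
  refine (congrArg₂ (fun v w : ℝ × ℝ × ℝ ↦ g.form 1 v w) (e v) (e w)).trans ((hab _ _).trans ?_)
  exact congrArg (fun r ↦ c * r)
    ((modelForm_eq_toOrigin p v w).symm.trans (modelMetric_form p v w).symm)

/-- A bilinear form of signature `(2, 1)` positive on `∂_z` has an adapted null basis of the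
orthogonal complement of `∂_z`. -/
theorem exists_adapted_basis (B : ℝ × ℝ × ℝ →L[ℝ] ℝ × ℝ × ℝ →L[ℝ] ℝ) (hs : ∀ v w, B v w = B w v)
    (hsig : ∃ v, B v v < 0 ∧ ∀ w, B v w = 0 → w ≠ 0 → 0 < B w w)
    (hz : 0 < B (0, 0, 1) (0, 0, 1)) :
    ∃ (a b : ℝ × ℝ × ℝ) (c : ℝ), 0 < c ∧ a.1 * b.2.1 - a.2.1 * b.1 ≠ 0 ∧ B a a = 0 ∧ B b b = 0 ∧
      B a (0, 0, 1) = 0 ∧ B b (0, 0, 1) = 0 ∧ B a b = c ∧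
      (a.1 * b.2.1 - a.2.1 * b.1) ^ 2 * B (0, 0, 1) (0, 0, 1) = c := by
  obtain ⟨v, hv, hpos⟩ := hsig
  set e : ℝ × ℝ × ℝ := (0, 0, 1) with he
  set d := B e e with hd
  have hd0 : d ≠ 0 := hz.ne'
  -- the component of `v` orthogonal to `e`
  obtain ⟨t, ht, hte⟩ : ∃ t, B t t < 0 ∧ B t e = 0 ∧ ∀ w, B w e = 0 → B v w = B t w := by
    refine ⟨v - (B v e / d) • e, ?_, ?_, ?_⟩
    · have : B (v - (B v e / d) • e) (v - (B v e / d) • e) = B v v - B v e ^ 2 / d := by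
        simp only [map_sub, map_smul, sub_apply, smul_apply, smul_eq_mul, hs e v, ← hd]
        field_simp
        ring
      rw [this]
      have : 0 ≤ B v e ^ 2 / d := by positivity
      linarith
    · simp only [map_sub, map_smul, sub_apply, smul_apply, smul_eq_mul, ← hd]
      field_simp
      ring
    · intro w hw
      simp only [map_sub, map_smul, sub_apply, smul_apply, smul_eq_mul, hs e w, hw]
      ring
  obtain ⟨hte, hvt⟩ := hte
  -- a non-zero vector orthogonal to `e` and `t`
  obtain ⟨s, hse, hst, hs0⟩ : ∃ s, B s e = 0 ∧ B t s = 0 ∧ s ≠ 0 := by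
    let f : ℝ × ℝ × ℝ →ₗ[ℝ] ℝ × ℝ := ((B e).prod (B t)).toLinearMap
    have hker : LinearMap.ker f ≠ ⊥ := LinearMap.ker_ne_bot_of_finrank_lt (by simp)
    obtain ⟨s, hs1, hs2⟩ := (Submodule.ne_bot_iff _).1 hker
    have h1 : (B e s, B t s) = ((0, 0) : ℝ × ℝ) := hs1
    exact ⟨s, (hs s e).trans (congrArg Prod.fst h1), congrArg Prod.snd h1, hs2⟩
  have hss : 0 < B s s := hpos s ((hvt s hse).trans hst) hs0
  obtain ⟨m, hm, hmm⟩ : ∃ m : ℝ, 0 < m ∧ m * m = -B t t :=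
    ⟨√(-B t t), Real.sqrt_pos.2 (by linarith), Real.mul_self_sqrt (by linarith)⟩
  obtain ⟨n, hn, hnn⟩ : ∃ n : ℝ, 0 < n ∧ n * n = B s s :=
    ⟨√(B s s), Real.sqrt_pos.2 hss, Real.mul_self_sqrt hss.le⟩
  -- If s and t were dependent modulo e, some combination would be a multiple of e orthogonal to e,
  -- hence zero, although s and t are orthogonal and non-null.
  have hΔ : s.1 * t.2.1 - s.2.1 * t.1 ≠ 0 := by
    intro h0
    have hcomb : ∀ x y : ℝ, x * s.1 = y * t.1 → x * s.2.1 = y * t.2.1 → x = 0 ∧ y = 0 := by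
      intro x y h1 h2
      have h3 : x • s - y • t = (x * s.2.2 - y * t.2.2) • e := by
        refine Prod.ext ?_ (Prod.ext ?_ ?_)
        · simp [he, h1]
        · simp [he, h2]
        · simp [he]
      have h4 : (x * s.2.2 - y * t.2.2) * d = 0 := by
        have := congrArg (fun u ↦ B u e) h3
        simp only [map_sub, map_smul, sub_apply, smul_apply, smul_eq_mul, hse, hte] at this
        linarith
      rw [(mul_eq_zero.1 h4).resolve_right hd0, zero_smul] at h3
      have h5 : x * B s s = 0 := by
        have := congrArg (fun u ↦ B u s) h3
        simpa [map_sub, map_smul, hst] using this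
      have h6 : y * B t t = 0 := by
        have := congrArg (fun u ↦ B u t) h3
        simpa [map_sub, map_smul, hst, hs s t] using this
      exact ⟨(mul_eq_zero.1 h5).resolve_right hss.ne', (mul_eq_zero.1 h6).resolve_right ht.ne⟩
    -- The pairs (t₁, s₁) and (t₂, s₂) solve the system when the determinant vanishes, so all four
    -- numbers are 0. Then (1, 0) is a solution too, which is absurd.
    obtain ⟨h1, h2⟩ := hcomb t.1 s.1 (by ring) (by linarith)
    obtain ⟨h3, h4⟩ := hcomb t.2.1 s.2.1 (by linarith) (by ring)
    have h5 := (hcomb 1 0 (by rw [h2]; ring) (by rw [h4]; ring)).1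
    exact one_ne_zero h5
  set Δ := s.1 * t.2.1 - s.2.1 * t.1 with hΔd
  -- `a = m s + n t`, `b = k (m s - n t)`
  have hq : 0 < m * n := mul_pos hm hn
  -- B(a, b) = 2k(mn)² and det(a, b)² d = 4k²(mn)²Δ²d; this k makes them equal.
  set k : ℝ := 1 / (2 * Δ ^ 2 * d) with hk
  have hΔ2 : 0 < Δ ^ 2 := by positivity
  have hkpos : 0 < k := by positivity
  have hdet : (m • s + n • t).1 * (k • (m • s - n • t)).2.1 -
      (m • s + n • t).2.1 * (k • (m • s - n • t)).1 = -(2 * k * (m * n)) * Δ := by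
    simp [hΔd]
    ring
  refine ⟨m • s + n • t, k • (m • s - n • t), 2 * k * (m * n) ^ 2, by positivity, ?_, ?_, ?_, ?_,
    ?_, ?_, ?_⟩
  · rw [hdet]
    exact mul_ne_zero (by linarith [mul_pos hkpos hq]) hΔ
  · simp only [map_add, map_smul, add_apply, smul_apply, smul_eq_mul, hs s t, hst, ← hnn]
    linear_combination (n * n) * hmm
  · simp only [map_sub, map_smul, sub_apply, smul_apply, smul_eq_mul, hs s t, hst, ← hnn]
    linear_combination (n * n * k ^ 2) * hmm
  · simp only [map_add, map_smul, add_apply, smul_apply, smul_eq_mul, hse, hte]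
    ring
  · simp only [map_sub, map_smul, sub_apply, smul_apply, smul_eq_mul, hse, hte]
    ring
  · simp only [map_add, map_sub, map_smul, add_apply, smul_apply, smul_eq_mul, hs s t, hst, ← hnn]
    linear_combination (-(n * n) * k) * hmm
  · rw [hdet, hk]
    field_simp

/-- Every left-invariant Lorentz metric which is positive on the center is the image of the model
metric by a homothetic automorphism. -/
theorem exists_normalForm {g : LorentzMetric 𝓘(ℝ, ℝ × ℝ × ℝ) Heis} (hg : LeftInvariant g)
    (hc : CenterPositive g) :
    ∃ (a b : ℝ × ℝ × ℝ) (h : a.1 * b.2.1 - a.2.1 * b.1 ≠ 0) (c : ℝ), 0 < c ∧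
      Homothety 𝓘(ℝ, ℝ × ℝ × ℝ) modelMetric.form g.form (heisAut a b h) c := by
  have hz : 0 < g.form 1 ((0, 0, 1) : ℝ × ℝ × ℝ) ((0, 0, 1) : ℝ × ℝ × ℝ) := by
    refine hc ((0, 0, 1) : ℝ × ℝ × ℝ) ((Heis.mem_center_iff _).2 ⟨rfl, rfl⟩) fun h ↦ ?_
    exact one_ne_zero (congrArg (fun u : ℝ × ℝ × ℝ ↦ u.2.2) h)
  obtain ⟨B, hB⟩ : ∃ B : ℝ × ℝ × ℝ →L[ℝ] ℝ × ℝ × ℝ →L[ℝ] ℝ, B = g.form 1 := ⟨g.form 1, rfl⟩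
  have hs : ∀ v w, B v w = B w v := by rw [hB]; exact g.symm 1
  obtain ⟨a, b, c, hc0, hdet, h1, h2, h3, h4, h5, h6⟩ := exists_adapted_basis B hs
    (by rw [hB]; exact g.signature 1) (by rw [hB]; exact hz)
  refine ⟨a, b, hdet, c, hc0, homothety_heisAut hg hdet fun v w ↦ ?_⟩
  have key : ∀ x y : ℝ × ℝ × ℝ, g.form 1 x y = B x y := fun x y ↦ by rw [hB]; rfl
  rw [key]
  simp only [map_add, map_smul, add_apply, smul_apply, smul_eq_mul, h1, h2, h3, h4, h5, hs b a,
    hs (0, 0, 1) a, hs (0, 0, 1) b, modelForm, Prod.fst_zero]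
  linear_combination (v.2.2 * w.2.2) * h6

end NormalForm

/-! ### The action of ℝ ⋉ Heis, and the identity component for the model. -/

section BoostAction

theorem Heis.ext_coord {p q : Heis} (h1 : p.1 = q.1) (h2 : p.2.1 = q.2.1) (h3 : p.2.2 = q.2.2) :
    p = q := Prod.ext h1 (Prod.ext h2 h3)

/-- The action of `ℝ ⋉ Heis` on `Heis`, as a function. -/
noncomputable def boostAct (a : BoostHeis) (p : Heis) : Heis :=
  a.2 * Heis.boost (Multiplicative.ofAdd a.1) p

theorem boostAct_eq (a : BoostHeis) (p : Heis) :
    boostAct a p = ((a.2.1 + Real.exp a.1 * p.1, a.2.2.1 + Real.exp (-a.1) * p.2.1,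
      a.2.2.2 + p.2.2 + a.2.1 * (Real.exp (-a.1) * p.2.1)) : ℝ × ℝ × ℝ) := rfl

theorem boostAct_mul (a b : BoostHeis) (p : Heis) :
    boostAct (a * b) p = boostAct a (boostAct b p) := by
  unfold boostAct
  rw [BoostHeis.mul_def]
  change a.2 * Heis.boost (Multiplicative.ofAdd a.1) b.2 *
    Heis.boost (Multiplicative.ofAdd a.1 * Multiplicative.ofAdd b.1) p = _
  rw [map_mul, map_mul, mul_assoc]
  rfl

theorem boostAct_one (p : Heis) : boostAct 1 p = p := by
  change (1 : Heis) * Heis.boost 1 p = p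
  rw [map_one, one_mul]
  rfl

theorem contMDiff_boostAct :
    ContMDiff (𝓘(ℝ, ℝ × ℝ × ℝ × ℝ).prod 𝓘(ℝ, ℝ × ℝ × ℝ)) 𝓘(ℝ, ℝ × ℝ × ℝ) ∞
      (fun q : BoostHeis × Heis ↦ boostAct q.1 q.2) := by
  have h : ContDiff ℝ ∞ (fun q : (ℝ × ℝ × ℝ × ℝ) × (ℝ × ℝ × ℝ) ↦
      ((q.1.2.1 + Real.exp q.1.1 * q.2.1, q.1.2.2.1 + Real.exp (-q.1.1) * q.2.2.1,
        q.1.2.2.2 + q.2.2.2 + q.1.2.1 * (Real.exp (-q.1.1) * q.2.2.1)) : ℝ × ℝ × ℝ)) := by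
    fun_prop
  have h' := h.contMDiff
  rw [modelWithCornersSelf_prod, ← chartedSpaceSelf_prod] at h'
  exact h'

/-- The action of `ℝ ⋉ Heis` on `Heis`. -/
noncomputable def boostAction : BoostHeis →* (Heis ≃ₜ Heis) where
  toFun a :=
    { toFun := boostAct a
      invFun := boostAct a⁻¹
      left_inv := fun p ↦ by rw [← boostAct_mul, inv_mul_cancel, boostAct_one]
      right_inv := fun p ↦ by rw [← boostAct_mul, mul_inv_cancel, boostAct_one]
      continuous_toFun := contMDiff_boostAct.continuous.comp (Continuous.prodMk_right a)
      continuous_invFun := contMDiff_boostAct.continuous.comp (Continuous.prodMk_right a⁻¹) }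
  map_one' := Homeomorph.ext boostAct_one
  map_mul' a b := Homeomorph.ext (boostAct_mul a b)

theorem boostAction_apply (a : BoostHeis) (p : Heis) : boostAction a p = boostAct a p := rfl

theorem smoothAction_boostAction :
    SmoothAction 𝓘(ℝ, ℝ × ℝ × ℝ × ℝ) 𝓘(ℝ, ℝ × ℝ × ℝ) boostAction := contMDiff_boostAct

theorem boostAction_left (h x : Heis) :
    boostAction ((0, h) : ℝ × Heis) x = h * x := by
  change h * Heis.boost 1 x = h * x
  rw [map_one]
  rfl

theorem boostAction_transitive (x y : Heis) : ∃ a, boostAction a x = y :=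
  ⟨((0, y * x⁻¹) : ℝ × Heis), by rw [boostAction_left, inv_mul_cancel_right]⟩

theorem mfderiv_boostAction (a : BoostHeis) (p : Heis) (v : ℝ × ℝ × ℝ) :
    (mfderiv 𝓘(ℝ, ℝ × ℝ × ℝ) 𝓘(ℝ, ℝ × ℝ × ℝ) (boostAction a) p v : ℝ × ℝ × ℝ) =
      (Real.exp a.1 * v.1, Real.exp (-a.1) * v.2.1,
        v.2.2 + a.2.1 * (Real.exp (-a.1) * v.2.1)) := by
  rw [Heis.mfderiv_eq]
  have hx : HasFDerivAt (fun y : ℝ × ℝ × ℝ ↦ y.1) (ContinuousLinearMap.fst ℝ ℝ (ℝ × ℝ)) p :=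
    (ContinuousLinearMap.fst ℝ ℝ (ℝ × ℝ)).hasFDerivAt
  have hy : HasFDerivAt (fun y : ℝ × ℝ × ℝ ↦ y.2.1)
    ((ContinuousLinearMap.fst ℝ ℝ ℝ).comp (ContinuousLinearMap.snd ℝ ℝ (ℝ × ℝ))) p :=
    ((ContinuousLinearMap.fst ℝ ℝ ℝ).comp (ContinuousLinearMap.snd ℝ ℝ (ℝ × ℝ))).hasFDerivAt
  have hz : HasFDerivAt (fun y : ℝ × ℝ × ℝ ↦ y.2.2)
    ((ContinuousLinearMap.snd ℝ ℝ ℝ).comp (ContinuousLinearMap.snd ℝ ℝ (ℝ × ℝ))) p :=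
    ((ContinuousLinearMap.snd ℝ ℝ ℝ).comp (ContinuousLinearMap.snd ℝ ℝ (ℝ × ℝ))).hasFDerivAt
  have key := ((hx.const_mul (Real.exp a.1)).const_add a.2.1).prodMk
    (((hy.const_mul (Real.exp (-a.1))).const_add a.2.2.1).prodMk
    ((hz.const_add a.2.2.2).add ((hy.const_mul (Real.exp (-a.1))).const_mul a.2.1)))
  exact congrArg (fun L : ℝ × ℝ × ℝ →L[ℝ] ℝ × ℝ × ℝ ↦ L v) key.fderiv

theorem preserves_boostAction (a : BoostHeis) :
    Preserves 𝓘(ℝ, ℝ × ℝ × ℝ) modelMetric.form (boostAction a) := by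
  have h : Real.exp a.1 * Real.exp (-a.1) = 1 := by
    rw [← Real.exp_add, add_neg_cancel, Real.exp_zero]
  intro p v w
  have key : ∀ v w : ℝ × ℝ × ℝ, modelForm
      (a.2.1 + Real.exp a.1 * p.1, a.2.2.1 + Real.exp (-a.1) * p.2.1,
        a.2.2.2 + p.2.2 + a.2.1 * (Real.exp (-a.1) * p.2.1))
      (Real.exp a.1 * v.1, Real.exp (-a.1) * v.2.1, v.2.2 + a.2.1 * (Real.exp (-a.1) * v.2.1))
      (Real.exp a.1 * w.1, Real.exp (-a.1) * w.2.1, w.2.2 + a.2.1 * (Real.exp (-a.1) * w.2.1)) =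
      modelForm p v w := by
    intro v w
    have e : ∀ u : ℝ × ℝ × ℝ, u.2.2 + a.2.1 * (Real.exp (-a.1) * u.2.1) -
        (a.2.1 + Real.exp a.1 * p.1) * (Real.exp (-a.1) * u.2.1) = u.2.2 - p.1 * u.2.1 :=
      fun u ↦ by linear_combination (-p.1 * u.2.1) * h
    unfold modelForm
    dsimp only
    rw [e, e]
    linear_combination (v.1 * w.2.1 + v.2.1 * w.1) * h
  refine (modelMetric_form _ _ _).trans (Eq.trans ?_ (modelMetric_form _ _ _).symm)
  exact (congrArg₂ (fun x y : ℝ × ℝ × ℝ ↦ modelForm (boostAction a p) x y)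
    (mfderiv_boostAction a p v) (mfderiv_boostAction a p w)).trans (key v w)

theorem boostAction_mem_isom (a : BoostHeis) : boostAction a ∈ isom modelMetric :=
  ⟨smoothAction_boostAction.contMDiff a, smoothAction_boostAction.contMDiff_symm a,
    preserves_boostAction a⟩

/-- The isometries of the model metric on the Heisenberg group. -/
theorem isom_modelMetric {ψ : Heis ≃ₜ Heis} (hψ : ψ ∈ isom modelMetric) :
    ∃ (h : ℝ × ℝ × ℝ) (a b : ℝ), a * b = 1 ∧
      ((∀ p : Heis, ψ p =
        ((h.1 + a * p.1, h.2.1 + b * p.2.1, h.2.2 + p.2.2 + h.1 * (b * p.2.1)) : ℝ × ℝ × ℝ)) ∨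
      (∀ p : Heis, ψ p = ((h.1 + a * p.2.1, h.2.1 + b * p.1,
        h.2.2 + (p.1 * p.2.1 - p.2.2) + h.1 * (b * p.1)) : ℝ × ℝ × ℝ))) := by
  obtain ⟨h1, h2, h3⟩ := hψ
  refine isometry_classification (f := ψ) (g := ψ.symm) ((Heis.contMDiff_iff _).1 h1)
    ((Heis.contMDiff_iff _).1 h2) ψ.apply_symm_apply ψ.symm_apply_apply fun p v w ↦ ?_
  have e : ∀ u : ℝ × ℝ × ℝ,
      (mfderiv 𝓘(ℝ, ℝ × ℝ × ℝ) 𝓘(ℝ, ℝ × ℝ × ℝ) ψ p u : ℝ × ℝ × ℝ) =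
        fderiv ℝ (E := ℝ × ℝ × ℝ) (F := ℝ × ℝ × ℝ) ψ p u := fun u ↦
    congrArg (fun L : ℝ × ℝ × ℝ →L[ℝ] ℝ × ℝ × ℝ ↦ L u) (Heis.mfderiv_eq ψ p)
  refine (congrArg₂ (fun x y : ℝ × ℝ × ℝ ↦ modelForm (ψ p) x y) (e v) (e w)).symm.trans ?_
  exact (modelMetric_form _ _ _).symm.trans ((h3 p v w).trans (modelMetric_form _ _ _))

theorem continuous_homeo_apply {M : Type*} [TopologicalSpace M] (p : M) :
    Continuous fun ψ : M ≃ₜ M ↦ ψ p := by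
  have h : Continuous fun ψ : M ≃ₜ M ↦ (⟨ψ, ψ.continuous⟩ : C(M, M)) := continuous_induced_dom
  exact (continuous_eval_const (F := C(M, M)) p).comp h

theorem Heis.continuous_fst : Continuous fun p : Heis ↦ p.1 :=
  _root_.continuous_fst (X := ℝ) (Y := ℝ × ℝ)

theorem Heis.continuous_snd : Continuous fun p : Heis ↦ p.2.1 :=
  (_root_.continuous_fst (X := ℝ) (Y := ℝ)).comp (_root_.continuous_snd (X := ℝ) (Y := ℝ × ℝ))

/-- The points `(1, 0, 0)` and `(0, 1, 0)` of the Heisenberg group. -/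
def Heis.pointX : Heis := ((1, 0, 0) : ℝ × ℝ × ℝ)

/-- The point `(0, 1, 0)`. -/
def Heis.pointY : Heis := ((0, 1, 0) : ℝ × ℝ × ℝ)

theorem continuous_boostAction : Continuous boostAction := by
  refine continuous_induced_rng.2 ?_
  exact ContinuousMap.continuous_of_continuous_uncurry _ contMDiff_boostAct.continuous

/-- The images of 1 and (1, 0, 0) determine the group element continuously: they yield (e^t, h),
which is an embedding in (t, h). -/
theorem isEmbedding_boostAction : Topology.IsEmbedding boostAction := by
  let K : (Heis ≃ₜ Heis) → ℝ × Heis := fun ψ ↦ ((ψ Heis.pointX).1 - (ψ 1).1, ψ 1)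
  have hK : Continuous K :=
    ((Heis.continuous_fst.comp (continuous_homeo_apply _)).sub
      (Heis.continuous_fst.comp (continuous_homeo_apply _))).prodMk (continuous_homeo_apply _)
  refine Topology.IsEmbedding.of_comp continuous_boostAction hK ?_
  have h : Topology.IsEmbedding (Prod.map Real.exp id : ℝ × (ℝ × ℝ × ℝ) → ℝ × (ℝ × ℝ × ℝ)) :=
    Real.isOpenEmbedding_exp.isEmbedding.prodMap Topology.IsEmbedding.id
  have e : K ∘ boostAction = (Prod.map Real.exp id : ℝ × (ℝ × ℝ × ℝ) → ℝ × (ℝ × ℝ × ℝ)) := by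
    funext a
    refine Prod.ext ?_ (Heis.ext_coord ?_ ?_ ?_)
    · change a.2.1 + Real.exp a.1 * 1 - (a.2.1 + Real.exp a.1 * 0) = Real.exp a.1
      ring
    · change a.2.1 + Real.exp a.1 * 0 = a.2.1
      ring
    · change a.2.2.1 + Real.exp (-a.1) * 0 = a.2.2.1
      ring
    · change a.2.2.2 + 0 + a.2.1 * (Real.exp (-a.1) * 0) = a.2.2.2
      ring
  rw [e]
  exact h

/-- The group is connected, which gives one inclusion. For the other, a continuous function
separates the identity component from the remaining isometries. -/
theorem range_boostAction : Set.range boostAction = isomZero modelMetric := by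
  apply Set.Subset.antisymm
  · have hconn : IsPreconnected (Set.range boostAction) := by
      have : PreconnectedSpace BoostHeis :=
        inferInstanceAs (PreconnectedSpace (ℝ × ℝ × ℝ × ℝ))
      exact isPreconnected_range continuous_boostAction
    refine hconn.subset_connectedComponentIn ⟨1, map_one _⟩ ?_
    rintro _ ⟨a, rfl⟩
    exact boostAction_mem_isom a
  · intro ψ hψ
    -- S is the trace of the linear part in (x, y): a + b with ab = 1, so |S| ≥ 2, or 0 when the
    -- null directions are exchanged. It never equals 1, and S = 2 at the identity.
    let S : (Heis ≃ₜ Heis) → ℝ := fun ψ ↦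
      ((ψ Heis.pointX).1 - (ψ 1).1) + ((ψ Heis.pointY).2.1 - (ψ 1).2.1)
    have hS : Continuous S :=
      ((Heis.continuous_fst.comp (continuous_homeo_apply _)).sub
        (Heis.continuous_fst.comp (continuous_homeo_apply _))).add
        ((Heis.continuous_snd.comp (continuous_homeo_apply _)).sub
        (Heis.continuous_snd.comp (continuous_homeo_apply _)))
    have hS1 : S 1 = 2 := by
      change ((1 : ℝ) - 0) + (1 - 0) = 2
      norm_num
    have hvalue : ∀ χ ∈ isom modelMetric, ∃ (h : ℝ × ℝ × ℝ) (a b : ℝ), a * b = 1 ∧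
        ((S χ = a + b ∧ ∀ p : Heis, χ p =
          ((h.1 + a * p.1, h.2.1 + b * p.2.1, h.2.2 + p.2.2 + h.1 * (b * p.2.1)) : ℝ × ℝ × ℝ)) ∨
        S χ = 0) := by
      intro χ hχ
      obtain ⟨h, a, b, hab, H | H⟩ := isom_modelMetric hχ
      · refine ⟨h, a, b, hab, Or.inl ⟨?_, H⟩⟩
        simp only [S, H]
        change h.1 + a * 1 - (h.1 + a * 0) + (h.2.1 + b * 1 - (h.2.1 + b * 0)) = a + b
        ring
      · refine ⟨h, a, b, hab, Or.inr ?_⟩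
        simp only [S, H]
        change h.1 + a * 0 - (h.1 + a * 0) + (h.2.1 + b * 0 - (h.2.1 + b * 0)) = 0
        ring
    have hsub : isomZero modelMetric ⊆ isom modelMetric := connectedComponentIn_subset _ _
    have h1 : (1 : Heis ≃ₜ Heis) ∈ isomZero modelMetric :=
      mem_connectedComponentIn (isom modelMetric).one_mem
    have hgt : 1 < S ψ := by
      by_contra hle
      obtain ⟨χ, hχ, hχ1⟩ := isPreconnected_connectedComponentIn.intermediate_value hψ h1
        hS.continuousOn (⟨not_lt.1 hle, by rw [hS1]; norm_num⟩ : (1 : ℝ) ∈ Set.Icc (S ψ) (S 1))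
      obtain ⟨h, a, b, hab, ⟨H, -⟩ | H⟩ := hvalue χ (hsub hχ)
      · nlinarith [sq_nonneg (a - b)]
      · linarith
    obtain ⟨h, a, b, hab, ⟨H, H'⟩ | H⟩ := hvalue ψ (hsub hψ)
    · have ha : 0 < a := by
        by_contra hna
        nlinarith [sq_nonneg b]
      have hb : Real.exp (-Real.log a) = b := by
        rw [Real.exp_neg, Real.exp_log ha]
        exact inv_eq_of_mul_eq_one_right hab
      refine ⟨((Real.log a, h) : ℝ × (ℝ × ℝ × ℝ)), Homeomorph.ext fun p ↦ ?_⟩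
      rw [H']
      refine (boostAct_eq _ p).trans ?_
      dsimp only
      rw [Real.exp_log ha, hb]
    · linarith

/-- The stabilizer of the identity consists of the boosts, with differential diag(e^t, e^{-t}, 1).
-/
theorem semisimpleIsotropy_boostAction :
    SemisimpleIsotropy 𝓘(ℝ, ℝ × ℝ × ℝ) boostAction 1 := by
  have hn : 3 = Module.finrank ℝ (ℝ × ℝ × ℝ) := by simp
  suffices H : ∃ (b : Module.Basis (Fin 3) ℝ (ℝ × ℝ × ℝ)) (c : Fin 3 → ℝ), c ≠ 0 ∧
      (∀ t : ℝ, ∃ a : BoostHeis, boostAction a 1 = 1 ∧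
        ∀ i, (mfderiv 𝓘(ℝ, ℝ × ℝ × ℝ) 𝓘(ℝ, ℝ × ℝ × ℝ) (boostAction a) 1 (b i) : ℝ × ℝ × ℝ) =
          Real.exp (t * c i) • b i) ∧
      (∀ a : BoostHeis, boostAction a 1 = 1 → ∃ t : ℝ,
        ∀ i, (mfderiv 𝓘(ℝ, ℝ × ℝ × ℝ) 𝓘(ℝ, ℝ × ℝ × ℝ) (boostAction a) 1 (b i) : ℝ × ℝ × ℝ) =
          Real.exp (t * c i) • b i) by
    unfold SemisimpleIsotropy
    rwa [← hn]
  have hfix : ∀ a : BoostHeis, boostAction a 1 = 1 ↔ a.2 = 1 := fun a ↦ by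
    rw [boostAction_apply, boostAct, map_one, mul_one]
  let e : (Fin 3 → ℝ) ≃ₗ[ℝ] ℝ × ℝ × ℝ :=
    { toFun := fun x ↦ (x 0, x 1, x 2)
      invFun := fun p ↦ ![p.1, p.2.1, p.2.2]
      map_add' := fun _ _ ↦ rfl
      map_smul' := fun _ _ ↦ rfl
      left_inv := fun x ↦ by ext i; fin_cases i <;> rfl
      right_inv := fun _ ↦ rfl }
  have he : ∀ x, e x = (x 0, x 1, x 2) := fun _ ↦ rfl
  clear_value e
  have hb : ∀ i, (Pi.basisFun ℝ (Fin 3)).map e i = e (Pi.single i 1) := fun i ↦ by simp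
  have hder : ∀ a : BoostHeis, a.2 = 1 → ∀ i,
      (mfderiv 𝓘(ℝ, ℝ × ℝ × ℝ) 𝓘(ℝ, ℝ × ℝ × ℝ) (boostAction a) 1
        ((Pi.basisFun ℝ (Fin 3)).map e i) : ℝ × ℝ × ℝ) =
          Real.exp (a.1 * (![1, -1, 0] : Fin 3 → ℝ) i) • (Pi.basisFun ℝ (Fin 3)).map e i := by
    intro a ha i
    have ha1 : a.2.1 = 0 := by rw [ha]; rfl
    rw [mfderiv_boostAction, ha1, hb]
    fin_cases i <;> simp [he] <;> rfl
  refine ⟨(Pi.basisFun ℝ (Fin 3)).map e, ![1, -1, 0], fun h ↦ ?_, fun t ↦ ?_, fun a ha ↦ ?_⟩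
  · simpa using congrFun h 0
  · exact ⟨((t, 1) : ℝ × Heis), (hfix _).2 rfl, hder ((t, 1) : ℝ × Heis) rfl⟩
  · exact ⟨a.1, hder a ((hfix a).1 ha)⟩

end BoostAction

/-! ### Dimension bound for groups of isometries of the model. -/

section Maximality

/-- Fixing 1 kills the translation part, and fixing (1, 0, 0) forces a = 1. If the null directions
are exchanged, 1 and (1, 0, 0) have images with the same first coordinate, so they cannot both be
fixed. -/
theorem eq_one_of_isom_fix {ψ : Heis ≃ₜ Heis} (hψ : ψ ∈ isom modelMetric) (h1 : ψ 1 = 1)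
    (hX : ψ Heis.pointX = Heis.pointX) : ψ = 1 := by
  obtain ⟨h, a, b, hab, H | H⟩ := isom_modelMetric hψ
  · rw [H] at h1 hX
    have e1 : h.1 + a * 0 = 0 := congrArg (fun p : ℝ × ℝ × ℝ ↦ p.1) h1
    have e2 : h.2.1 + b * 0 = 0 := congrArg (fun p : ℝ × ℝ × ℝ ↦ p.2.1) h1
    have e3 : h.2.2 + 0 + h.1 * (b * 0) = 0 := congrArg (fun p : ℝ × ℝ × ℝ ↦ p.2.2) h1
    have e4 : h.1 + a * 1 = 1 := congrArg (fun p : ℝ × ℝ × ℝ ↦ p.1) hX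
    have ha : a = 1 := by linarith
    have hb : b = 1 := by rw [ha] at hab; linarith
    have f1 : h.1 = 0 := by linarith
    have f2 : h.2.1 = 0 := by linarith
    have f3 : h.2.2 = 0 := by linarith
    refine Homeomorph.ext fun p ↦ ?_
    rw [H, ha, hb, f1, f2, f3]
    refine Heis.ext_coord ?_ ?_ ?_
    · change 0 + 1 * p.1 = p.1
      ring
    · change 0 + 1 * p.2.1 = p.2.1
      ring
    · change 0 + p.2.2 + 0 * (1 * p.2.1) = p.2.2
      ring
  · rw [H] at h1 hX
    have e1 : h.1 + a * 0 = 0 := congrArg (fun p : ℝ × ℝ × ℝ ↦ p.1) h1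
    have e4 : h.1 + a * 0 = 1 := congrArg (fun p : ℝ × ℝ × ℝ ↦ p.1) hX
    linarith

/-- Once the image of 1 is known, that of (1, 0, 0) carries a single new parameter. This is what
lowers the dimension bound from 6 to 4. -/
theorem isom_snd_eq {ψ : Heis ≃ₜ Heis} (hψ : ψ ∈ isom modelMetric)
    (h0 : (ψ Heis.pointX).1 - (ψ 1).1 ≠ 0) : (ψ Heis.pointX).2 = (ψ 1).2 := by
  obtain ⟨h, a, b, hab, H | H⟩ := isom_modelMetric hψ
  · rw [H, H]
    refine Prod.ext ?_ ?_
    · change h.2.1 + b * 0 = h.2.1 + b * 0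
      rfl
    · change h.2.2 + 0 + h.1 * (b * 0) = h.2.2 + 0 + h.1 * (b * 0)
      rfl
  · rw [H, H] at h0
    exact absurd (sub_self (h.1 + a * 0)) h0

/-- A map which is singular along an integral curve is locally constant along it. -/
theorem eventually_const_of_integralCurve {n : ℕ} {G : Type*} [TopologicalSpace G]
    [ChartedSpace (EuclideanSpace ℝ (Fin n)) G]
    {V : ∀ a : G, TangentSpace (𝓡 n) a} {γ : ℝ → G}
    (hγ : IsMIntegralCurveAt γ V 0) {F : G → ℝ × ℝ × ℝ}
    (hF : ContMDiff (𝓡 n) 𝓘(ℝ, ℝ × ℝ × ℝ) ∞ F)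
    (hV : ∀ a, (mfderiv (𝓡 n) 𝓘(ℝ, ℝ × ℝ × ℝ) F a (V a) : ℝ × ℝ × ℝ) = 0) :
    ∀ᶠ t in nhds (0 : ℝ), F (γ t) = F (γ 0) := by
  obtain ⟨r, hr, hball⟩ := Metric.eventually_nhds_iff_ball.1 hγ
  have hd : ∀ t ∈ Metric.ball (0 : ℝ) r, HasFDerivAt (F ∘ γ) (0 : ℝ →L[ℝ] ℝ × ℝ × ℝ) t := by
    intro t ht
    have h1 := ((hF (γ t)).mdifferentiableAt (by simp)).hasMFDerivAt.comp t (hball t ht)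
    have h2 := hasMFDerivAt_iff_hasFDerivAt.1 h1
    refine h2.congr_fderiv ?_
    refine ContinuousLinearMap.ext fun (s : ℝ) ↦ ?_
    have h3 : ∀ w : EuclideanSpace ℝ (Fin n), w = s • (show EuclideanSpace ℝ (Fin n) from V (γ t)) →
        (mfderiv (𝓡 n) 𝓘(ℝ, ℝ × ℝ × ℝ) F (γ t) w : ℝ × ℝ × ℝ) = 0 := by
      rintro _ rfl
      exact ((mfderiv (𝓡 n) 𝓘(ℝ, ℝ × ℝ × ℝ) F (γ t)).map_smul s (V (γ t))).trans
        ((congrArg (fun u : ℝ × ℝ × ℝ ↦ s • u) (hV (γ t))).trans (smul_zero s))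
    exact h3 _ rfl
  filter_upwards [Metric.ball_mem_nhds (0 : ℝ) hr] with t ht
  exact Metric.isOpen_ball.is_const_of_fderiv_eq_zero (𝕜 := ℝ) (f := F ∘ γ)
    (convex_ball (0 : ℝ) r).isPreconnected
    (fun t ht ↦ (hd t ht).differentiableAt.differentiableWithinAt)
    (fun t ht ↦ (hd t ht).fderiv) ht (Metric.mem_ball_self hr)

section LieGroupAction

variable {n : ℕ} {G : Type*} [Group G] [TopologicalSpace G]
  [ChartedSpace (EuclideanSpace ℝ (Fin n)) G] [LieGroup (𝓡 n) ∞ G]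

/-- If the orbit map of `p` is singular in the direction `v` at `1`, then it is singular everywhere
in the direction of the left-invariant field of `v`. -/
theorem mfderiv_orbit_mulInvariantVectorField {ρ : G →* (Heis ≃ₜ Heis)}
    (hρ : SmoothAction (𝓡 n) 𝓘(ℝ, ℝ × ℝ × ℝ) ρ) (p : Heis) (v : GroupLieAlgebra (𝓡 n) G)
    (hv : (mfderiv (𝓡 n) 𝓘(ℝ, ℝ × ℝ × ℝ) (fun a ↦ ρ a p) 1 v : ℝ × ℝ × ℝ) = 0) (a : G) :
    (mfderiv (𝓡 n) 𝓘(ℝ, ℝ × ℝ × ℝ) (fun a ↦ ρ a p) a (mulInvariantVectorField v a) :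
      ℝ × ℝ × ℝ) = 0 := by
  have hF : ContMDiff (𝓡 n) 𝓘(ℝ, ℝ × ℝ × ℝ) ∞ (fun a ↦ ρ a p) := hρ.contMDiff_orbit p
  have hL : ContMDiff (𝓡 n) (𝓡 n) ∞ (fun b : G ↦ a * b) := contMDiff_mul_left
  have e1 := mfderiv_comp (1 : G) ((hF (a * 1)).mdifferentiableAt (by simp))
    ((hL 1).mdifferentiableAt (by simp))
  have e2 := mfderiv_comp (1 : G) (((hρ.contMDiff a) (ρ 1 p)).mdifferentiableAt (by simp))
    ((hF 1).mdifferentiableAt (by simp))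
  -- The orbit map intertwines left translation by a with ρ a.
  rw [show (fun a ↦ ρ a p) ∘ (fun b ↦ a * b) = (ρ a) ∘ (fun a ↦ ρ a p) from
    funext fun b ↦ by simp [map_mul], e2] at e1
  have e3 := congrArg (fun T ↦ (T v : ℝ × ℝ × ℝ)) e1
  have e4 : ∀ (b : G) (_ : b = a) (w : EuclideanSpace ℝ (Fin n)),
      (mfderiv (𝓡 n) 𝓘(ℝ, ℝ × ℝ × ℝ) (fun a ↦ ρ a p) b w : ℝ × ℝ × ℝ) =
      mfderiv (𝓡 n) 𝓘(ℝ, ℝ × ℝ × ℝ) (fun a ↦ ρ a p) a w := by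
    rintro _ rfl w; rfl
  have e5 : (mfderiv 𝓘(ℝ, ℝ × ℝ × ℝ) 𝓘(ℝ, ℝ × ℝ × ℝ) (ρ a) (ρ 1 p)
      (mfderiv (𝓡 n) 𝓘(ℝ, ℝ × ℝ × ℝ) (fun a ↦ ρ a p) 1 v) : ℝ × ℝ × ℝ) = 0 := by
    have : ∀ w : ℝ × ℝ × ℝ, w = 0 →
        (mfderiv 𝓘(ℝ, ℝ × ℝ × ℝ) 𝓘(ℝ, ℝ × ℝ × ℝ) (ρ a) (ρ 1 p) w : ℝ × ℝ × ℝ) = 0 := by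
      rintro _ rfl; exact map_zero _
    exact this _ hv
  exact ((e4 (a * 1) (mul_one a) _).symm.trans e3.symm).trans e5

/-- A Lie group acting faithfully by isometries of the model metric has dimension at most `4`. -/
theorem dim_le_of_isometric_action (hn : 4 < n) {ρ : G →* (Heis ≃ₜ Heis)}
    (hρ : SmoothAction (𝓡 n) 𝓘(ℝ, ℝ × ℝ × ℝ) ρ) (hinj : Function.Injective ρ)
    (hiso : ∀ a, ρ a ∈ isom modelMetric) : False := by
  have hF : ∀ p, ContMDiff (𝓡 n) 𝓘(ℝ, ℝ × ℝ × ℝ) ∞ (fun a ↦ ρ a p) := hρ.contMDiff_orbit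
  let D : Heis → EuclideanSpace ℝ (Fin n) →L[ℝ] ℝ × ℝ × ℝ := fun p ↦
    mfderiv (𝓡 n) 𝓘(ℝ, ℝ × ℝ × ℝ) (fun a ↦ ρ a p) 1
  have hsnd : ∀ p, HasMFDerivAt (𝓡 n) 𝓘(ℝ, ℝ × ℝ) (fun a : G ↦ ((ρ a p).2 : ℝ × ℝ)) 1
      ((ContinuousLinearMap.snd ℝ ℝ (ℝ × ℝ)).comp (D p)) := fun p ↦
    ((ContinuousLinearMap.snd ℝ ℝ (ℝ × ℝ)).hasMFDerivAt (x := (ρ 1 p : ℝ × ℝ × ℝ))).comp 1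
      (((hF p) 1).mdifferentiableAt (by simp)).hasMFDerivAt
  -- Near the identity of G the difference of first coordinates stays close to 1, so the null
  -- directions are not exchanged.
  have hev : (fun a : G ↦ ((ρ a Heis.pointX).2 : ℝ × ℝ)) =ᶠ[nhds 1]
      fun a : G ↦ ((ρ a 1).2 : ℝ × ℝ) := by
    have hc : Continuous fun a : G ↦ (ρ a Heis.pointX).1 - (ρ a 1).1 :=
      (Heis.continuous_fst.comp (hF _).continuous).sub (Heis.continuous_fst.comp (hF _).continuous)
    have h1 : (ρ 1 Heis.pointX).1 - (ρ 1 1).1 ≠ 0 := by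
      rw [map_one]
      change (1 : ℝ) - 0 ≠ 0
      norm_num
    filter_upwards [hc.continuousAt.eventually_ne h1] with a ha
    exact isom_snd_eq (hiso a) ha
  have hDsnd : ∀ v, (D Heis.pointX v).2 = (D 1 v).2 := fun v ↦
    congrArg (fun L : EuclideanSpace ℝ (Fin n) →L[ℝ] ℝ × ℝ ↦ L v)
      (hasMFDerivAt_unique (hsnd Heis.pointX) ((hsnd 1).congr_of_eventuallyEq hev))
  -- Killing v under both orbit differentials imposes only 3 + 1 linear conditions, and n > 4.
  obtain ⟨v, hv0, hv1, hvX⟩ : ∃ v, v ≠ 0 ∧ D 1 v = 0 ∧ D Heis.pointX v = 0 := by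
    let f : EuclideanSpace ℝ (Fin n) →ₗ[ℝ] (ℝ × ℝ × ℝ) × ℝ :=
      ((D 1).prod ((ContinuousLinearMap.fst ℝ ℝ (ℝ × ℝ)).comp (D Heis.pointX))).toLinearMap
    have hker : LinearMap.ker f ≠ ⊥ := LinearMap.ker_ne_bot_of_finrank_lt (by simpa using hn)
    obtain ⟨v, hv, hv0⟩ := (Submodule.ne_bot_iff _).1 hker
    have h1 : (D 1 v, (D Heis.pointX v).1) = (0, 0) := hv
    have h2 : D 1 v = 0 := congrArg Prod.fst h1
    exact ⟨v, hv0, h2, Prod.ext (congrArg Prod.snd h1) ((hDsnd v).trans (by rw [h2]))⟩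
  have : LieGroup (𝓡 n) (minSmoothness ℝ 3) G := by
    rw [minSmoothness_of_isRCLikeNormedField]
    exact LieGroup.of_le (n := ∞) (WithTop.coe_le_coe.2 (le_top : (3 : ℕ∞) ≤ ⊤))
  have : IsManifold (𝓡 n) 1 G := IsManifold.of_le (n := ∞) (by simp)
  -- A local integral curve of the left-invariant field plays the role of the one-parameter subgroup
  -- of v. It fixes both points, so by faithfulness it is constant, contradicting v ≠ 0.
  obtain ⟨γ, hγ0, hγ⟩ := exists_isMIntegralCurveAt_of_contMDiffAt_boundaryless (I := 𝓡 n)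
    (v := mulInvariantVectorField (I := 𝓡 n) (G := G) v) (x₀ := 1) 0
    (((contMDiff_mulInvariantVectorField (I := 𝓡 n) (G := G) v).of_le (by simp)).contMDiffAt)
  have hfix : ∀ p, (D p v = 0) → ∀ᶠ t in nhds (0 : ℝ), ρ (γ t) p = p := by
    intro p hp
    filter_upwards [eventually_const_of_integralCurve hγ (hF p)
      (mfderiv_orbit_mulInvariantVectorField hρ p v hp)] with t ht
    refine ht.trans ?_
    rw [hγ0, map_one]
    rfl
  have hone : γ =ᶠ[nhds 0] fun _ ↦ 1 := by
    filter_upwards [hfix 1 hv1, hfix _ hvX] with t h1 h2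
    exact hinj ((eq_one_of_isom_fix (hiso _) h1 h2).trans (map_one ρ).symm)
  have h1 := hγ.hasMFDerivAt
  have h2 : HasMFDerivAt 𝓘(ℝ, ℝ) (𝓡 n) γ 0 (0 : ℝ →L[ℝ] EuclideanSpace ℝ (Fin n)) :=
    (hasMFDerivAt_const (1 : G) (0 : ℝ)).congr_of_eventuallyEq hone
  have h3 := congrArg (fun L : ℝ →L[ℝ] EuclideanSpace ℝ (Fin n) ↦ L 1) (hasMFDerivAt_unique h1 h2)
  have h4 : (mulInvariantVectorField (I := 𝓡 n) (G := G) v (γ 0) : EuclideanSpace ℝ (Fin n)) = 0 := by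
    refine Eq.trans ?_ h3
    exact (one_smul ℝ _).symm
  have h5 : ∀ (b : G) (_ : b = 1), (mulInvariantVectorField (I := 𝓡 n) (G := G) v b :
      EuclideanSpace ℝ (Fin n)) = v := by
    rintro _ rfl
    unfold mulInvariantVectorField
    rw [show (fun x : G ↦ 1 * x) = id from funext one_mul, mfderiv_id]
    rfl
  exact hv0 ((h5 _ hγ0).symm.trans h4)

end LieGroupAction

end Maximality

/-! ### Lorentz metrics preserved by the four-dimensional group. -/

section InvariantMetrics

variable {a b : ℝ × ℝ × ℝ} {h : a.1 * b.2.1 - a.2.1 * b.1 ≠ 0}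

theorem conjAction_heisAut_apply (k : BoostHeis) (x : Heis) :
    conjAction (heisAutHomeo a b h) boostAction k (heisAut a b h x) =
      heisAut a b h (boostAction k x) :=
  congrArg (fun y ↦ heisAut a b h (boostAction k y)) ((heisAut a b h).symm_apply_apply x)

/-- Conjugation by an automorphism carries left translations to left translations, so the conjugated
action still contains all of them. -/
theorem leftInvariant_of_preserves {g : LorentzMetric 𝓘(ℝ, ℝ × ℝ × ℝ) Heis}
    (hg : ∀ k, Preserves 𝓘(ℝ, ℝ × ℝ × ℝ) g.form
      (conjAction (heisAutHomeo a b h) boostAction k)) : LeftInvariant g := by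
  intro x
  obtain ⟨y, rfl⟩ := (heisAut a b h).surjective x
  obtain ⟨k, hk⟩ : ∃ k, ∀ z, boostAction k z = y * z := ⟨_, boostAction_left y⟩
  have e : (fun z ↦ heisAut a b h y * z) = conjAction (heisAutHomeo a b h) boostAction k := by
    funext z
    obtain ⟨w, rfl⟩ := (heisAut a b h).surjective z
    rw [conjAction_heisAut_apply, hk, map_mul]
  rw [e]
  exact hg _

/-- A form invariant by the boosts `diag (e^t, e^{-t}, 1)`. -/
theorem boost_invariant_form (B : ℝ × ℝ × ℝ →L[ℝ] ℝ × ℝ × ℝ →L[ℝ] ℝ)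
    (hB : ∀ v w : ℝ × ℝ × ℝ,
      B (Real.exp 1 * v.1, Real.exp (-1) * v.2.1, v.2.2)
        (Real.exp 1 * w.1, Real.exp (-1) * w.2.1, w.2.2) = B v w) :
    B (1, 0, 0) (1, 0, 0) = 0 ∧ B (0, 1, 0) (0, 1, 0) = 0 ∧ B (1, 0, 0) (0, 0, 1) = 0 ∧
      B (0, 1, 0) (0, 0, 1) = 0 := by
  have hE : 1 < Real.exp 1 := Real.one_lt_exp_iff.2 one_pos
  have hE' : Real.exp (-1) < 1 := Real.exp_lt_one_iff.2 (by norm_num)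
  have hE0 := Real.exp_pos (-1)
  have s1 : ∀ r : ℝ, ((r * 1, 0, 0) : ℝ × ℝ × ℝ) = r • (1, 0, 0) := fun r ↦ by simp
  have s2 : ∀ r : ℝ, ((0, r * 1, 0) : ℝ × ℝ × ℝ) = r • (0, 1, 0) := fun r ↦ by simp
  -- The boost multiplies these four entries by e², e⁻², e and e⁻¹, none of which is 1.
  have h1 := hB (1, 0, 0) (1, 0, 0)
  have h2 := hB (0, 1, 0) (0, 1, 0)
  have h3 := hB (1, 0, 0) (0, 0, 1)
  have h4 := hB (0, 1, 0) (0, 0, 1)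
  simp only [mul_zero, s1, s2, map_smul, smul_apply, smul_eq_mul] at h1 h2 h3 h4
  refine ⟨?_, ?_, ?_, ?_⟩
  · have : (Real.exp 1 * Real.exp 1 - 1) * B (1, 0, 0) (1, 0, 0) = 0 := by linarith
    exact (mul_eq_zero.1 this).resolve_left (by nlinarith)
  · have : (Real.exp (-1) * Real.exp (-1) - 1) * B (0, 1, 0) (0, 1, 0) = 0 := by linarith
    exact (mul_eq_zero.1 this).resolve_left (by nlinarith)
  · have : (Real.exp 1 - 1) * B (1, 0, 0) (0, 0, 1) = 0 := by linarith
    exact (mul_eq_zero.1 this).resolve_left (by linarith)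
  · have : (Real.exp (-1) - 1) * B (0, 1, 0) (0, 0, 1) = 0 := by linarith
    exact (mul_eq_zero.1 this).resolve_left (by linarith)

/-- A form of signature `(2, 1)` which is invariant by the boosts is positive on the fixed
direction. -/
theorem boost_invariant_pos (B : ℝ × ℝ × ℝ →L[ℝ] ℝ × ℝ × ℝ →L[ℝ] ℝ) (hs : ∀ v w, B v w = B w v)
    (hsig : ∃ v, B v v < 0 ∧ ∀ w, B v w = 0 → w ≠ 0 → 0 < B w w)
    (hB : ∀ v w : ℝ × ℝ × ℝ,
      B (Real.exp 1 * v.1, Real.exp (-1) * v.2.1, v.2.2)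
        (Real.exp 1 * w.1, Real.exp (-1) * w.2.1, w.2.2) = B v w) :
    0 < B (0, 0, 1) (0, 0, 1) := by
  obtain ⟨h1, h2, h3, h4⟩ := boost_invariant_form B hB
  obtain ⟨v, -, hpos⟩ := hsig
  by_contra hneg
  rw [not_lt] at hneg
  -- One of X + Y, X - Y has non-positive square. With Z it spans a plane on which the form is
  -- non-positive, if B(Z, Z) ≤ 0.
  obtain ⟨m, hm1, hm2, hm3, hm4⟩ : ∃ m : ℝ × ℝ × ℝ, m.1 = 1 ∧ m.2.2 = 0 ∧ B m m ≤ 0 ∧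
      B m (0, 0, 1) = 0 := by
    have e : ∀ r : ℝ, ((1, r, 0) : ℝ × ℝ × ℝ) = (1, 0, 0) + r • (0, 1, 0) := fun r ↦ by simp
    have e1 : ∀ r : ℝ, B (1, r, 0) (1, r, 0) = 2 * r * B (1, 0, 0) (0, 1, 0) := fun r ↦ by
      rw [e]
      simp only [map_add, map_smul, add_apply, smul_apply, smul_eq_mul, h1, h2,
        hs (0, 1, 0) (1, 0, 0)]
      ring
    have e2 : ∀ r : ℝ, B (1, r, 0) (0, 0, 1) = 0 := fun r ↦ by
      rw [e]
      simp only [map_add, map_smul, add_apply, smul_apply, smul_eq_mul, h3, h4]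
      ring
    rcases le_total (B (1, 0, 0) (0, 1, 0)) 0 with hle | hle
    · exact ⟨(1, 1, 0), rfl, rfl, by rw [e1]; linarith, e2 _⟩
    · exact ⟨(1, -1, 0), rfl, rfl, by rw [e1]; linarith, e2 _⟩
  have hvm : B v m ≠ 0 := fun h0 ↦
    (hpos m h0 fun h ↦ by simp [h] at hm1).not_ge hm3
  -- A non-zero vector of that plane orthogonal to the timelike v must have positive square, a
  -- contradiction.
  have hw := hpos (B v (0, 0, 1) • m - B v m • ((0, 0, 1) : ℝ × ℝ × ℝ))
    (by simp only [map_sub, map_smul, smul_eq_mul]; ring)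
    (fun h0 ↦ hvm (by
      have := congrArg (fun p : ℝ × ℝ × ℝ ↦ p.2.2) h0
      simpa [hm2] using this))
  simp only [map_sub, map_smul, sub_apply, smul_apply, smul_eq_mul, hm4, hs (0, 0, 1) m] at hw
  nlinarith [mul_nonneg (mul_self_nonneg (B v (0, 0, 1))) (neg_nonneg.2 hm3),
    mul_nonneg (mul_self_nonneg (B v m)) (neg_nonneg.2 hneg)]

/-- The pull-back by the automorphism is invariant under the unconjugated action, so at the identity
it is a boost-invariant form, positive on Z. The automorphism maps the center to itself. -/
theorem centerPositive_of_preserves {g : LorentzMetric 𝓘(ℝ, ℝ × ℝ × ℝ) Heis}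
    (hg : ∀ k, Preserves 𝓘(ℝ, ℝ × ℝ × ℝ) g.form
      (conjAction (heisAutHomeo a b h) boostAction k)) : CenterPositive g := by
  have sf := contMDiff_heisAut a b h
  have sh := contMDiff_heisAut_symm a b h
  -- the pull-back of the metric
  let A : Heis → ℝ × ℝ × ℝ →L[ℝ] ℝ × ℝ × ℝ := fun p ↦
    mfderiv 𝓘(ℝ, ℝ × ℝ × ℝ) 𝓘(ℝ, ℝ × ℝ × ℝ) (heisAut a b h) p
  let Q : Heis → ℝ × ℝ × ℝ →L[ℝ] ℝ × ℝ × ℝ →L[ℝ] ℝ := fun p ↦ g.form (heisAut a b h p)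
  let P : BilinField 𝓘(ℝ, ℝ × ℝ × ℝ) Heis := fun p ↦ (Q p).bilinearComp (A p) (A p)
  have hP : Homothety 𝓘(ℝ, ℝ × ℝ × ℝ) P g.form (heisAutHomeo a b h) 1 := fun p v w ↦
    (one_mul _).symm
  have hinv : ∀ k, Homothety 𝓘(ℝ, ℝ × ℝ × ℝ) P P (boostAction k) 1 := by
    intro k
    have sk : ContMDiff 𝓘(ℝ, ℝ × ℝ × ℝ) 𝓘(ℝ, ℝ × ℝ × ℝ) ∞
        (conjAction (heisAutHomeo a b h) boostAction k) :=
      (smoothAction_boostAction.conj (φ := heisAutHomeo a b h) sf sh).contMDiff k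
    have := (hP.symm one_ne_zero sf sh).comp
      ((preserves_iff_homothety.1 (hg k)).comp hP sk sf) sh (sk.comp sf)
    rw [show (heisAutHomeo a b h).symm ∘
      (conjAction (heisAutHomeo a b h) boostAction k) ∘ (heisAutHomeo a b h) = boostAction k from
      funext fun x ↦ by
        change (heisAut a b h).symm (conjAction (heisAutHomeo a b h) boostAction k
          (heisAut a b h x)) = _
        rw [conjAction_heisAut_apply, MulEquiv.symm_apply_apply]] at this
    simpa using this
  obtain ⟨B, hB⟩ : ∃ B : ℝ × ℝ × ℝ →L[ℝ] ℝ × ℝ × ℝ →L[ℝ] ℝ, B = P 1 := ⟨P 1, rfl⟩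
  have hBP : ∀ v w : ℝ × ℝ × ℝ, B v w = Q 1 (A 1 v) (A 1 w) := by
    rw [hB]; intro v w; rfl
  have hpos : 0 < B (0, 0, 1) (0, 0, 1) := by
    refine boost_invariant_pos B (fun v w ↦ ?_) ?_ fun v w ↦ ?_
    · rw [hBP, hBP]
      exact g.symm _ _ _
    · obtain ⟨v, hv, hvpos⟩ : ∃ v : ℝ × ℝ × ℝ, Q 1 v v < 0 ∧
          ∀ w : ℝ × ℝ × ℝ, Q 1 v w = 0 → w ≠ 0 → 0 < Q 1 w w := g.signature (heisAut a b h 1)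
      let Φ : Heis ≃ₘ^∞⟮𝓘(ℝ, ℝ × ℝ × ℝ), 𝓘(ℝ, ℝ × ℝ × ℝ)⟯ Heis :=
        ⟨(heisAut a b h).toEquiv, sf, sh⟩
      let L : (ℝ × ℝ × ℝ) ≃L[ℝ] (ℝ × ℝ × ℝ) := Φ.mfderivToContinuousLinearEquiv (by simp) 1
      have hL : ∀ v, A 1 v = L v := fun _ ↦ rfl
      refine ⟨L.symm v, ?_, fun w hw hw0 ↦ ?_⟩
      · rw [hBP, hL, L.apply_symm_apply]
        exact hv
      · rw [hBP, hL, L.apply_symm_apply] at hw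
        rw [hBP]
        exact hvpos (A 1 w) hw fun h0 ↦ hw0 (L.map_eq_zero_iff.1 h0)
    · obtain ⟨k, hk1, hk2⟩ : ∃ k : BoostHeis, k.1 = 1 ∧ k.2 = 1 := ⟨((1, 1) : ℝ × Heis), rfl, rfl⟩
      have hk : boostAction k 1 = 1 := by
        rw [boostAction_apply, boostAct, hk2, map_one, mul_one]
      have hd : ∀ u : ℝ × ℝ × ℝ,
          (mfderiv 𝓘(ℝ, ℝ × ℝ × ℝ) 𝓘(ℝ, ℝ × ℝ × ℝ) (boostAction k) 1 u : ℝ × ℝ × ℝ) =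
          (Real.exp 1 * u.1, Real.exp (-1) * u.2.1, u.2.2) := fun u ↦ by
        rw [mfderiv_boostAction, hk1, hk2]
        refine Prod.ext rfl (Prod.ext rfl ?_)
        change u.2.2 + 0 * (Real.exp (-1) * u.2.1) = u.2.2
        ring
      rw [← hd, ← hd, hB]
      exact (P.congr_point hk _ _).symm.trans ((hinv k 1 v w).trans (one_mul _))
  intro X hX hX0
  obtain ⟨hX1, hX2⟩ := (Heis.mem_center_iff X).1 hX
  obtain ⟨z, hz⟩ : ∃ z : ℝ, z = X.2.2 := ⟨_, rfl⟩
  have hz0 : z ≠ 0 := fun h0 ↦ hX0 (Prod.ext hX1 (Prod.ext hX2 (hz.symm.trans h0)))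
  -- The automorphism multiplies Z by the determinant, so r Z is the preimage of X.
  set r : ℝ := (a.1 * b.2.1 - a.2.1 * b.1)⁻¹ * z with hr
  have hAX : A 1 (r • (0, 0, 1)) = X := by
    refine (mfderiv_heisAut a b h 1 _).trans ?_
    refine Prod.ext ?_ (Prod.ext ?_ ?_)
    · refine Eq.trans ?_ hX1.symm
      simp
    · refine Eq.trans ?_ hX2.symm
      simp
    · refine Eq.trans ?_ hz
      simp [hr, mul_inv_cancel_left₀ h]
  have h1 := hBP (r • (0, 0, 1)) (r • (0, 0, 1))
  rw [hAX] at h1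
  have h2 : Q 1 X X = g.form 1 X X := g.form.congr_point (map_one (heisAut a b h)) X X
  refine lt_of_lt_of_eq ?_ (h1.trans h2)
  simp only [map_smul, smul_apply, smul_eq_mul]
  have hr0 : r ≠ 0 := mul_ne_zero (inv_ne_zero h) hz0
  rw [← mul_assoc]
  exact mul_pos (mul_self_pos.2 hr0) hpos

end InvariantMetrics

/-! ### The properties of the geometry for an arbitrary metric of the class. -/

section Main

variable {a b : ℝ × ℝ × ℝ} {h : a.1 * b.2.1 - a.2.1 * b.1 ≠ 0}

/-- The metric preserved by the larger group is preserved by G, hence homothetic to the model.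
Conjugating by the homothety brings the larger group under the bound of
`dim_le_of_isometric_action`. -/
theorem isMaximalGeometry_conj :
    IsMaximalGeometry 𝓘(ℝ, ℝ × ℝ × ℝ × ℝ) 𝓘(ℝ, ℝ × ℝ × ℝ)
      (conjAction (heisAutHomeo a b h) boostAction) := by
  rintro n hn G' _ _ _ _ ρ' hρ' hinj ⟨g, hg⟩ ⟨j, hj⟩
  have hn' : 4 < n := by simpa [modelDim] using hn
  have hgG : ∀ k, Preserves 𝓘(ℝ, ℝ × ℝ × ℝ) g.form
      (conjAction (heisAutHomeo a b h) boostAction k) := fun k ↦ by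
    rw [← hj]
    exact hg _
  obtain ⟨a', b', h', c, hc, H⟩ := exists_normalForm (leftInvariant_of_preserves hgG)
    (centerPositive_of_preserves hgG)
  have sf := contMDiff_heisAut a' b' h'
  have sh := contMDiff_heisAut_symm a' b' h'
  have H' : Homothety 𝓘(ℝ, ℝ × ℝ × ℝ) g.form modelMetric.form
      ((heisAutHomeo a' b' h')⁻¹ : Heis ≃ₜ Heis) c⁻¹ :=
    Homothety.symm (φ := heisAutHomeo a' b' h') H hc.ne' sf sh
  exact dim_le_of_isometric_action hn' (hρ'.conj (φ := (heisAutHomeo a' b' h')⁻¹) sh sf)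
    (conjAction_injective hinj _) fun x ↦ conj_mem_isom H' (inv_ne_zero hc.ne') sh sf
      ⟨hρ'.contMDiff x, hρ'.contMDiff_symm x, hg x⟩

/-- Two transports from the identity: along its orbit, where ρ k intertwines the action with its
twist by an inner automorphism, then through the automorphism that conjugates the action. -/
theorem semisimpleIsotropy_conj (p : Heis) :
    SemisimpleIsotropy 𝓘(ℝ, ℝ × ℝ × ℝ) (conjAction (heisAutHomeo a b h) boostAction) p := by
  have sf := contMDiff_heisAut a b h
  have sh := contMDiff_heisAut_symm a b h
  have hs := smoothAction_boostAction.contMDiff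
  obtain ⟨q, rfl⟩ := (heisAutHomeo a b h).surjective p
  obtain ⟨k, rfl⟩ := boostAction_transitive 1 q
  have h1 : SemisimpleIsotropy 𝓘(ℝ, ℝ × ℝ × ℝ) boostAction (boostAction k 1) :=
    semisimpleIsotropy_boostAction.transport hs hs (hs k)
      (smoothAction_boostAction.contMDiff_symm k) (e := MulAut.conj k) (MulAut.conj k).surjective
      fun x y ↦ by
        rw [MulAut.conj_apply, map_mul, map_mul, map_inv]
        exact congrArg (fun z ↦ boostAction k (boostAction x z))
          ((boostAction k).symm_apply_apply y)
  exact h1.transport hs (smoothAction_boostAction.conj (φ := heisAutHomeo a b h) sf sh).contMDiff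
    (φ := heisAutHomeo a b h) sf sh (e := id) Function.surjective_id
    fun x y ↦ conjAction_heisAut_apply x y

theorem isIsomZero_conj {g : LorentzMetric 𝓘(ℝ, ℝ × ℝ × ℝ) Heis} {c : ℝ} (hc : c ≠ 0)
    (H : Homothety 𝓘(ℝ, ℝ × ℝ × ℝ) modelMetric.form g.form (heisAut a b h) c) :
    IsIsomZero (conjAction (heisAutHomeo a b h) boostAction) g where
  isEmbedding := (conjHomeo (heisAutHomeo a b h)).isEmbedding.comp isEmbedding_boostAction
  range_eq := by
    rw [← image_conj_isomZero (φ := heisAutHomeo a b h) H hc (contMDiff_heisAut a b h)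
      (contMDiff_heisAut_symm a b h), ← range_boostAction, ← Set.range_comp]
    rfl

theorem isLorentzGeometry_conj {g : LorentzMetric 𝓘(ℝ, ℝ × ℝ × ℝ) Heis} {c : ℝ} (hc : c ≠ 0)
    (H : Homothety 𝓘(ℝ, ℝ × ℝ × ℝ) modelMetric.form g.form (heisAut a b h) c) :
    IsLorentzGeometry 𝓘(ℝ, ℝ × ℝ × ℝ × ℝ) 𝓘(ℝ, ℝ × ℝ × ℝ)
      (conjAction (heisAutHomeo a b h) boostAction) where
  smooth := smoothAction_boostAction.conj (contMDiff_heisAut a b h) (contMDiff_heisAut_symm a b h)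
  faithful := conjAction_injective isEmbedding_boostAction.injective _
  transitive x y := by
    obtain ⟨x, rfl⟩ := (heisAut a b h).surjective x
    obtain ⟨y, rfl⟩ := (heisAut a b h).surjective y
    obtain ⟨k, hk⟩ := boostAction_transitive x y
    exact ⟨k, by rw [conjAction_heisAut_apply, hk]⟩
  lorentz := ⟨g, fun k ↦ (conj_mem_isom (φ := heisAutHomeo a b h) H hc (contMDiff_heisAut a b h)
    (contMDiff_heisAut_symm a b h) (boostAction_mem_isom k)).2.2⟩

/-- Two left-invariant Lorentz metrics which are positive on the center are homothetic by an
automorphism. -/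
theorem exists_homothety {g₁ g₂ : LorentzMetric 𝓘(ℝ, ℝ × ℝ × ℝ) Heis}
    (hl₁ : LeftInvariant g₁) (hc₁ : CenterPositive g₁) (hl₂ : LeftInvariant g₂)
    (hc₂ : CenterPositive g₂) :
    ∃ (σ : Heis ≃* Heis) (c : ℝ), 0 < c ∧
      ContMDiff 𝓘(ℝ, ℝ × ℝ × ℝ) 𝓘(ℝ, ℝ × ℝ × ℝ) ∞ σ ∧
      ContMDiff 𝓘(ℝ, ℝ × ℝ × ℝ) 𝓘(ℝ, ℝ × ℝ × ℝ) ∞ σ.symm ∧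
      Homothety 𝓘(ℝ, ℝ × ℝ × ℝ) g₁.form g₂.form σ c := by
  obtain ⟨a, b, h, c, hc, H₁⟩ := exists_normalForm hl₁ hc₁
  obtain ⟨a', b', h', c', hc', H₂⟩ := exists_normalForm hl₂ hc₂
  have sf := contMDiff_heisAut a b h
  have sh := contMDiff_heisAut_symm a b h
  have sf' := contMDiff_heisAut a' b' h'
  have sh' := contMDiff_heisAut_symm a' b' h'
  exact ⟨(heisAut a b h).symm.trans (heisAut a' b' h'), c' * c⁻¹, by positivity, sf'.comp sh,
    sf.comp sh', H₂.comp (Homothety.symm (φ := heisAutHomeo a b h) H₁ hc.ne' sf sh) sf' sh⟩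

end Main

end LorentzHeis

open LorentzHeis in
theorem mainTheorem7 :
    (∃ g : LorentzMetric 𝓘(ℝ, ℝ × ℝ × ℝ) Heis, LeftInvariant g ∧ CenterPositive g) ∧
    (∀ g₁ g₂ : LorentzMetric 𝓘(ℝ, ℝ × ℝ × ℝ) Heis,
      LeftInvariant g₁ → CenterPositive g₁ → LeftInvariant g₂ → CenterPositive g₂ →
      (∃ (σ : Heis ≃* Heis) (c : ℝ), 0 < c ∧
        ContMDiff 𝓘(ℝ, ℝ × ℝ × ℝ) 𝓘(ℝ, ℝ × ℝ × ℝ) ∞ σ ∧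
        ContMDiff 𝓘(ℝ, ℝ × ℝ × ℝ) 𝓘(ℝ, ℝ × ℝ × ℝ) ∞ σ.symm ∧
        ∀ (x : Heis) (v w : TangentSpace 𝓘(ℝ, ℝ × ℝ × ℝ) x),
          g₂.form (σ x) (mfderiv 𝓘(ℝ, ℝ × ℝ × ℝ) 𝓘(ℝ, ℝ × ℝ × ℝ) σ x v)
            (mfderiv 𝓘(ℝ, ℝ × ℝ × ℝ) 𝓘(ℝ, ℝ × ℝ × ℝ) σ x w) = c * g₁.form x v w) ∧
      SameGeometry g₁ g₂) ∧
    (∀ g : LorentzMetric 𝓘(ℝ, ℝ × ℝ × ℝ) Heis, LeftInvariant g → CenterPositive g →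
      ∃ ρ : BoostHeis →* (Heis ≃ₜ Heis),
        IsIsomZero ρ g ∧
        modelDim 𝓘(ℝ, ℝ × ℝ × ℝ × ℝ) = 4 ∧
        IsLorentzGeometry 𝓘(ℝ, ℝ × ℝ × ℝ × ℝ) 𝓘(ℝ, ℝ × ℝ × ℝ) ρ ∧
        NonRiemannian 𝓘(ℝ, ℝ × ℝ × ℝ) ρ ∧
        IsMaximalGeometry 𝓘(ℝ, ℝ × ℝ × ℝ × ℝ) 𝓘(ℝ, ℝ × ℝ × ℝ) ρ ∧
        ∀ p : Heis, SemisimpleIsotropy 𝓘(ℝ, ℝ × ℝ × ℝ) ρ p) := by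
  refine ⟨⟨modelMetric, leftInvariant_modelMetric, centerPositive_modelMetric⟩,
    fun g₁ g₂ hl₁ hc₁ hl₂ hc₂ ↦ ?_, fun g hl hc ↦ ?_⟩
  · obtain ⟨σ, c, hc, sf, sh, H⟩ := exists_homothety hl₁ hc₁ hl₂ hc₂
    let φ : Heis ≃ₜ Heis := ⟨σ.toEquiv, sf.continuous, sh.continuous⟩
    exact ⟨⟨σ, c, hc, sf, sh, H⟩, sameGeometry_of_homothety (φ := φ) H hc.ne' sf sh⟩
  · obtain ⟨a, b, h, c, hc0, H⟩ := exists_normalForm hl hc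
    exact ⟨conjAction (heisAutHomeo a b h) boostAction, isIsomZero_conj hc0.ne' H,
      by simp [modelDim], isLorentzGeometry_conj hc0.ne' H,
      (semisimpleIsotropy_conj 1).nonRiemannian, isMaximalGeometry_conj, semisimpleIsotropy_conj⟩
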